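/- Let $n\ge 1$, let $v_1,\dots,v_p\in\mathbb Z^n$ and $\lambda_1,\dots,\lambda_p\in\mathbb R$ (for example the ray generators of the fan of a toric Fano manifold and the coefficients of an ample toric divisor). Put $\chi_k(x)=\lambda_k+\langle v_k,x\rangle$, $G_{\mathrm{trop}}=\{x\in\mathbb R^n:\chi_k(x)\ge 0\ \forall k\}$, $F_{j,\mathrm{trop}}=\{x\in G_{\mathrm{trop}}:\chi_j(x)=0\}$, and for $t>0$ put $W_\Sigma(z)=1+\sum_{k=1}^p t^{\lambda_k}z^{v_k}$ and $\mathrm{Log}_t(z)=(\log|z_1|,\dots,\log|z_n|)/\log t$ on $(\mathbb C^*)^n$. Fix $j$. Let $U_j''\subset\subset U_j'\subset\subset U_j$ be open subsets of $\mathbb R^n$ such that $U_j''$ meets $F_{j,\mathrm{trop}}$, and such that there are constants $c_j<c_k$ $(k\ne j)$ with $\chi_j<c_j$ and $\chi_k>c_k$ on $U_j$ for all $k\neq j$. For a function $\rho$ on $\mathbb R^n$ put $$W_{\Sigma,j}(z)=W_\Sigma(z)-\rho(\mathrm{Log}_t z)\sum_{k\ne j}t^{\lambda_k}z^{v_k},\qquad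 \beta_{x,\mathrm{amoeba}}=(x+\mathbb R v_j)\cap U_j\cap \mathrm{Log}_t\big(\{z\in(\mathbb C^*)^n: W_{\Sigma,j}(z)=0\}\big).$$ Call $\rho$ an admissible cut-off function (for $t$) if it is smooth with values in $[0,1]$, equal to $1$ on $U_j''$ and to $0$ outside $U_j'$, and constant on $\beta_{x,\mathrm{amoeba}}$ for every $x\in U_j\cap F_{j,\mathrm{trop}}$. Let $\beta\subset G_{\mathrm{trop}}$ be the tropical curve cut out in $G_{\mathrm{trop}}$ by tropical polynomials $f_1,\dots,f_{n-1}$ with integral exponents, and let $e$ be an edge of $\beta$ with direction $v_j$ and with an end $a\in U_j\cap F_{j,\mathrm{trop}}$. Let its dual cell be the Minkowski sum $\sigma_e=\sigma_1+\dots+\sigma_{n-1}$, where the cell $\sigma_k$ dual to $a$ of the subdivision of the Newton polytope of $f_k$ is an integral segment with edge vector $\xi_k\in\mathbb Z^n$, where $\xi_1,\dots,\xi_{n-1}$ are linearly independent and orthogonal to $v_j$. The weight $w(e)=\mathrm{vol}_{\mathrm{int}}(\sigma_e)$ is the volume of $\sigma_e$ normalized by the lattice of integral vectors parallel to $\sigma_e$.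 Let $\gamma\in\mathbb Z^n$ with $\langle\gamma,v_j\rangle=1$. Let $K\subset U_j\cap F_{j,\mathrm{trop}}$ be a set such that for some $\delta>0$ one has $x+rv_j\in U_j$ for all $x\in K$ and $|r|<\delta$ (for example, any compact subset of $U_j\cap F_{j,\mathrm{trop}}$, in particular any single point). Then there is $t_0>0$ such that for every $0<t<t_0$, every admissible cut-off function $\rho$ for $t$, and every $x\in K$ the following hold. (1) For every $\eta\in\mathbb R^{n-1}$ there are a unique $\tau=\tau_x(\eta)\in\mathbb R$ and a unique $\alpha=\alpha_x(\eta)\in\mathbb R/2\pi\mathbb Z$ with $x+\tau v_j\in\beta_{x,\mathrm{amoeba}}$ and $W_{\Sigma,j}\big(\exp(\log t\,(x+\tau v_j)+\sqrt{-1}(\alpha\gamma+\sum_i\eta_i\xi_i))\big)=0$. (2) The singular fiber $SF_{x,e}$, parametrized by $(\theta_0,\eta_a,\eta)\in[0,2\pi]^{n+1}\mapsto(z,u,v)$ with $$z=\exp\Big(\log t\,(x+\tau_x(\eta)v_j)+\sqrt{-1}\big((\alpha_x(\eta)+\eta_a)\gamma+\textstyle\sum_i\eta_i\xi_i\big)\Big),\quad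 u=|W_{\Sigma,j}(z)|^{1/2}e^{\sqrt{-1}\theta_0},\quad v=W_{\Sigma,j}(z)\,|W_{\Sigma,j}(z)|^{-1/2}e^{-\sqrt{-1}\theta_0}$$ (and $v=0$ where $W_{\Sigma,j}(z)=0$), is an $(n+1)$-cycle in $\{(z,u,v)\in(\mathbb C^*)^n\times\mathbb C^2: uv=W_{\Sigma,j}(z)\}$: the parametrization is continuous, has values in this hypersurface, and takes the same values on opposite faces of the cube. (3) The parametrization is differentiable with $u\ne0$ at almost every point of the cube, the pullback of $\Omega=d\log u\wedge d\log z_1\wedge\cdots\wedge d\log z_n$ under it is integrable over the cube, and $$\int_{SF_{x,e}}\Omega=(2\pi\sqrt{-1})^{n+1}w(e),$$ where $SF_{x,e}$ is oriented by $\partial_{\theta_0}\wedge\partial_{\eta_a}\wedge or(\sigma_e)$ and $or(\sigma_e)$ is the orientation for which $v_j\wedge or(\sigma_e)$ is the standard orientation of $\mathbb R^n$. -/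

import Mathlib

open MeasureTheory Set

noncomputable section

namespace TropicalPeriod

/-- An integral vector, regarded as a real vector. -/
def realVec {n : ℕ} (m : Fin n → ℤ) : Fin n → ℝ := fun i => (m i : ℝ)

/-! ### The polytope, its facets and the Laurent polynomial -/

/-- The affine function `χ_k(x) = λ_k + ⟨v_k, x⟩`. -/
def chi {n p : ℕ} (v : Fin p → Fin n → ℤ) (lam : Fin p → ℝ) (k : Fin p) (x : Fin n → ℝ) : ℝ :=
  lam k + ∑ i, (v k i : ℝ) * x i

/-- The polytope `G_trop = {x | χ_k(x) ≥ 0 for all k}`. -/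
def polytope {n p : ℕ} (v : Fin p → Fin n → ℤ) (lam : Fin p → ℝ) : Set (Fin n → ℝ) :=
  {x | ∀ k, 0 ≤ chi v lam k x}

/-- The facet `F_{j,trop}` of `G_trop` dual to `v_j`. -/
def facet {n p : ℕ} (v : Fin p → Fin n → ℤ) (lam : Fin p → ℝ) (j : Fin p) : Set (Fin n → ℝ) :=
  {x | x ∈ polytope v lam ∧ chi v lam j x = 0}

/-- The Laurent monomial `z^m`. -/
def monomial {n : ℕ} (m : Fin n → ℤ) (z : Fin n → ℂ) : ℂ := ∏ i, z i ^ m i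

/-- The Laurent polynomial `W_Σ(z) = 1 + ∑_k t^{λ_k} z^{v_k}`. -/
def W {n p : ℕ} (v : Fin p → Fin n → ℤ) (lam : Fin p → ℝ) (t : ℝ) (z : Fin n → ℂ) : ℂ :=
  1 + ∑ k, ((t ^ lam k : ℝ) : ℂ) * monomial (v k) z

/-- The rescaled logarithm map `Log_t(z) = (log |z_1|, …, log |z_n|) / log t`. -/
def LogT {n : ℕ} (t : ℝ) (z : Fin n → ℂ) : Fin n → ℝ := fun i => Real.log ‖z i‖ / Real.log t

/-- The deformed function
`W_{Σ,j}(z) = W_Σ(z) - ρ(Log_t z) ∑_{k ≠ j} t^{λ_k} z^{v_k}`, for a cut-off function `ρ`. -/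
def Wj {n p : ℕ} (v : Fin p → Fin n → ℤ) (lam : Fin p → ℝ) (j : Fin p) (t : ℝ)
    (ρ : (Fin n → ℝ) → ℝ) (z : Fin n → ℂ) : ℂ :=
  W v lam t z
    - (ρ (LogT t z) : ℂ) *
      ∑ k ∈ Finset.univ.filter (fun k => k ≠ j), ((t ^ lam k : ℝ) : ℂ) * monomial (v k) z

/-- The rescaled amoeba `Log_t({z ∈ (ℂ^*)^n | g(z) = 0})` of a function `g`. -/
def amoeba {n : ℕ} (t : ℝ) (g : (Fin n → ℂ) → ℂ) : Set (Fin n → ℝ) :=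
  LogT t '' {z | (∀ i, z i ≠ 0) ∧ g z = 0}

/-- Open sets `U'' ⊂⊂ U' ⊂⊂ U` that meet the facet `F_{j,trop}`, where on `U` the function `χ_j`
is smaller than all the other `χ_k`, with a gap: there are constants `c_j < c_k` (`k ≠ j`) with
`χ_j < c_j` and `c_k < χ_k` on `U`. -/
structure FacetNeighborhoods {n p : ℕ} (v : Fin p → Fin n → ℤ) (lam : Fin p → ℝ)
    (j : Fin p) where
  U : Set (Fin n → ℝ)
  U' : Set (Fin n → ℝ)
  U'' : Set (Fin n → ℝ)
  isOpen_U : IsOpen U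
  isOpen_U' : IsOpen U'
  isOpen_U'' : IsOpen U''
  compact_U' : IsCompact (closure U')
  compact_U'' : IsCompact (closure U'')
  closure_U'_subset : closure U' ⊆ U
  closure_U''_subset : closure U'' ⊆ U'
  meets_facet : (U'' ∩ facet v lam j).Nonempty
  gap : ∃ c : Fin p → ℝ, (∀ k, k ≠ j → c j < c k) ∧
    ∀ y ∈ U, chi v lam j y < c j ∧ ∀ k, k ≠ j → c k < chi v lam k y

/-- The set `β_{x,amoeba} = (x + ℝ v_j) ∩ U ∩ 𝒜_t(W_{Σ,j})`. -/
def betaAmoeba {n p : ℕ} (v : Fin p → Fin n → ℤ) (lam : Fin p → ℝ) (j : Fin p)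
    (U : Set (Fin n → ℝ)) (t : ℝ) (ρ : (Fin n → ℝ) → ℝ) (x : Fin n → ℝ) : Set (Fin n → ℝ) :=
  {y | ∃ τ : ℝ, y = x + τ • realVec (v j)} ∩ U ∩ amoeba t (Wj v lam j t ρ)

/-- An admissible cut-off function: smooth, with values in `[0, 1]`, equal to `1` on `U''` and to
`0` outside `U'`, and constant on `β_{x,amoeba}` for every `x ∈ U ∩ F_{j,trop}`. -/
structure IsCutoff {n p : ℕ} {v : Fin p → Fin n → ℤ} {lam : Fin p → ℝ} {j : Fin p}
    (N : FacetNeighborhoods v lam j) (t : ℝ) (ρ : (Fin n → ℝ) → ℝ) : Prop where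
  smooth : ContDiff ℝ (⊤ : ℕ∞) ρ
  mem_Icc : ∀ y, ρ y ∈ Icc (0 : ℝ) 1
  eq_one : ∀ y ∈ N.U'', ρ y = 1
  eq_zero : ∀ y, y ∉ N.U' → ρ y = 0
  const_on : ∀ x ∈ N.U ∩ facet v lam j, ∀ y ∈ betaAmoeba v lam j N.U t ρ x,
    ∀ y' ∈ betaAmoeba v lam j N.U t ρ x, ρ y = ρ y'

/-! ### Tropical curves, dual cells and weights -/

/-- A tropical (max-plus) Laurent polynomial `x ↦ max_{m ∈ A} (c_m + ⟨m, x⟩)`. -/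
structure TropPoly (n : ℕ) where
  support : Finset (Fin n → ℤ)
  nonempty : support.Nonempty
  coeff : (Fin n → ℤ) → ℝ

/-- The exponents whose term attains the maximum at `x`. -/
def TropPoly.maximizers {n : ℕ} (f : TropPoly n) (x : Fin n → ℝ) : Set (Fin n → ℤ) :=
  {m | m ∈ f.support ∧ ∀ m' ∈ f.support,
    f.coeff m' + ∑ i, (m' i : ℝ) * x i ≤ f.coeff m + ∑ i, (m i : ℝ) * x i}

/-- The tropical hypersurface: the maximum is attained at least twice. -/
def TropPoly.hypersurface {n : ℕ} (f : TropPoly n) : Set (Fin n → ℝ) :=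
  {x | (f.maximizers x).Nontrivial}

/-- The cell, dual to `x`, of the regular subdivision of the Newton polytope defined by `f`. -/
def TropPoly.dualCell {n : ℕ} (f : TropPoly n) (x : Fin n → ℝ) : Set (Fin n → ℝ) :=
  convexHull ℝ (realVec '' f.maximizers x)

/-- The tropical complete intersection curve of `f_1, …, f_{n-1}`, cut off by `G`
(here `n = d + 1`). -/
def tropicalCurve {d : ℕ} (f : Fin d → TropPoly (d + 1)) (G : Set (Fin (d + 1) → ℝ)) :
    Set (Fin (d + 1) → ℝ) :=
  {x | x ∈ G ∧ ∀ k, x ∈ (f k).hypersurface}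

/-- The mixed cell `σ = σ_1 + ⋯ + σ_{n-1}` dual to the point `x` (a Minkowski sum); it is the cell
dual to the edge `e` when `x` is a point of `e` that is not a vertex of the curve. -/
def mixedCell {d : ℕ} (f : Fin d → TropPoly (d + 1)) (x : Fin (d + 1) → ℝ) :
    Set (Fin (d + 1) → ℝ) :=
  {y | ∃ s : Fin d → Fin (d + 1) → ℝ, (∀ k, s k ∈ (f k).dualCell x) ∧ y = ∑ k, s k}

/-- The integral points of the linear space parallel to the affine span of `S`. -/
def latticeOf {n : ℕ} (S : Set (Fin n → ℝ)) : Submodule ℤ (Fin n → ℤ) where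
  carrier := {m | realVec m ∈ vectorSpan ℝ S}
  add_mem' := by
    intro a b ha hb
    have h : realVec (a + b) = realVec a + realVec b := by
      funext i; simp [realVec]
    simpa only [mem_ofPred_eq, h] using Submodule.add_mem _ ha hb
  zero_mem' := by
    have h : realVec (0 : Fin n → ℤ) = 0 := by funext i; simp [realVec]
    simp only [mem_ofPred_eq, h, Submodule.zero_mem]
  smul_mem' := by
    intro c a ha
    have h : realVec (c • a) = (c : ℝ) • realVec a := by
      funext i; simp [realVec]
    simpa only [mem_ofPred_eq, h] using Submodule.smul_mem _ _ ha

/-- The integral volume `vol_int(S)` of an integral polytope `S` of any dimension: its volume in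
its affine span, measured in coordinates with respect to a `ℤ`-basis of the parallel lattice
(with a point of `S` as origin; neither choice matters). -/
def intVolume {n : ℕ} (S : Set (Fin n → ℝ)) : ℝ :=
  volume.real {y : Fin (Module.finrank ℤ (latticeOf S)) → ℝ |
    Classical.epsilon (fun q : Fin n → ℝ => q ∈ S)
      + ∑ i, y i • realVec (Module.finBasis ℤ (latticeOf S) i : Fin n → ℤ) ∈ S}

/-- The weight `w(e) = vol_int(σ_e)` of the edge of the tropical curve through the
(non-vertex) point `a`. -/
def edgeWeight {d : ℕ} (f : Fin d → TropPoly (d + 1)) (a : Fin (d + 1) → ℝ) : ℝ :=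
  intVolume (mixedCell f a)

/-- The tropical curve of `f_1, …, f_{n-1}`, cut off by `G_trop`, has an edge `e` with end `a` on
`F_{j,trop}`, with direction `v_j` and with dual cell `σ_e = ξ_1 + ⋯ + ξ_{n-1}`: the cells of
`f_1, …, f_{n-1}` dual to `a` are integral segments with linearly independent edge vectors
`ξ_1, …, ξ_{n-1}`, all of them orthogonal to `v_j`. -/
structure IsEdgeEnd {d p : ℕ} (v : Fin p → Fin (d + 1) → ℤ) (lam : Fin p → ℝ) (j : Fin p)
    (f : Fin d → TropPoly (d + 1)) (a : Fin (d + 1) → ℝ) (ξ : Fin d → Fin (d + 1) → ℤ) :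
    Prop where
  mem_curve : a ∈ tropicalCurve f (polytope v lam)
  mem_facet : a ∈ facet v lam j
  cell : ∀ k, ∃ q : Fin (d + 1) → ℤ,
    (f k).dualCell a = segment ℝ (realVec q) (realVec (q + ξ k))
  indep : LinearIndependent ℝ (fun k => realVec (ξ k))
  perp : ∀ k, ∑ i, v j i * ξ k i = 0

/-! ### The singular fiber -/

/-- The ambient space of the points `(z, u, v)`. -/
abbrev Ambient (n : ℕ) : Type := (Fin n → ℂ) × ℂ × ℂ

/-- The hypersurface `{(z, u, v) ∈ (ℂ^*)^n × ℂ^2 | u v = W_{Σ,j}(z)}`. -/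
def simpleModel {n p : ℕ} (v : Fin p → Fin n → ℤ) (lam : Fin p → ℝ) (j : Fin p) (t : ℝ)
    (ρ : (Fin n → ℝ) → ℝ) : Set (Ambient n) :=
  {P | (∀ i, P.1 i ≠ 0) ∧ P.2.1 * P.2.2 = Wj v lam j t ρ P.1}

/-- The point `exp(log t · (x + τ v_j) + √-1 (α γ + ∑_i η_i ξ_i))` of `(ℂ^*)^n`. -/
def zPoint {d : ℕ} (vj γ : Fin (d + 1) → ℤ) (ξ : Fin d → Fin (d + 1) → ℤ) (t : ℝ)
    (x : Fin (d + 1) → ℝ) (τ α : ℝ) (η : Fin d → ℝ) : Fin (d + 1) → ℂ :=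
  fun i => Complex.exp
    (((Real.log t * (x i + τ * (vj i : ℝ)) : ℝ) : ℂ)
      + Complex.I * ((α * (γ i : ℝ) + ∑ k, η k * (ξ k i : ℝ) : ℝ) : ℂ))

/-- `(τ, α)` solves the equation that defines `(τ_x(η), α_x(η))`:
`x + τ v_j ∈ β_{x,amoeba}` and `W_{Σ,j}` vanishes at the point with parameters `τ, α, η`. The class
`α ∈ ℝ/2πℤ` is represented by a number in `[0, 2π)`. -/
def IsSolution {d p : ℕ} (v : Fin p → Fin (d + 1) → ℤ) (lam : Fin p → ℝ) (j : Fin p)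
    (U : Set (Fin (d + 1) → ℝ)) (t : ℝ) (ρ : (Fin (d + 1) → ℝ) → ℝ)
    (γ : Fin (d + 1) → ℤ) (ξ : Fin d → Fin (d + 1) → ℤ) (x : Fin (d + 1) → ℝ)
    (η : Fin d → ℝ) (s : ℝ × ℝ) : Prop :=
  s.2 ∈ Ico 0 (2 * Real.pi) ∧
  x + s.1 • realVec (v j) ∈ betaAmoeba v lam j U t ρ x ∧
  Wj v lam j t ρ (zPoint (v j) γ ξ t x s.1 s.2 η) = 0

/-- The pair `(τ_x(η), α_x(η))`. -/
def solution {d p : ℕ} (v : Fin p → Fin (d + 1) → ℤ) (lam : Fin p → ℝ) (j : Fin p)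
    (U : Set (Fin (d + 1) → ℝ)) (t : ℝ) (ρ : (Fin (d + 1) → ℝ) → ℝ)
    (γ : Fin (d + 1) → ℤ) (ξ : Fin d → Fin (d + 1) → ℤ) (x : Fin (d + 1) → ℝ)
    (η : Fin d → ℝ) : ℝ × ℝ :=
  Classical.epsilon (IsSolution v lam j U t ρ γ ξ x η)

/-- The parametrization `(θ_0, η_a, η_1, …, η_{n-1}) ↦ (z, u, v)` of the singular fiber
`SF_{x,e}`. -/
def singularFiber {d p : ℕ} (v : Fin p → Fin (d + 1) → ℤ) (lam : Fin p → ℝ) (j : Fin p)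
    (U : Set (Fin (d + 1) → ℝ)) (t : ℝ) (ρ : (Fin (d + 1) → ℝ) → ℝ)
    (γ : Fin (d + 1) → ℤ) (ξ : Fin d → Fin (d + 1) → ℤ) (x : Fin (d + 1) → ℝ)
    (s : Fin (d + 2) → ℝ) : Ambient (d + 1) :=
  let θ₀ : ℝ := s 0
  let ηa : ℝ := s 1
  let η : Fin d → ℝ := fun k => s k.succ.succ
  let τα : ℝ × ℝ := solution v lam j U t ρ γ ξ x η
  let z : Fin (d + 1) → ℂ := zPoint (v j) γ ξ t x τα.1 (τα.2 + ηa) η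
  let w : ℂ := Wj v lam j t ρ z
  (z, ((Real.sqrt ‖w‖ : ℝ) : ℂ) * Complex.exp (Complex.I * (θ₀ : ℂ)),
    w / ((Real.sqrt ‖w‖ : ℝ) : ℂ) * Complex.exp (-(Complex.I * (θ₀ : ℂ))))

/-- The parameter cube `[0, 2π]^m`. -/
def cube (m : ℕ) : Set (Fin m → ℝ) := Icc (fun _ => 0) (fun _ => 2 * Real.pi)

/-! ### The form and its integral -/

/-- The form `Ω = d log u ∧ d log z_1 ∧ ⋯ ∧ d log z_n` at the point `P`, evaluated on the tangent
vectors `X_0, …, X_n`. -/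
def Omega {n : ℕ} (P : Ambient n) (X : Fin (n + 1) → Ambient n) : ℂ :=
  Matrix.det (Matrix.of fun r c : Fin (n + 1) =>
    (Fin.cons ((X c).2.1 / P.2.1) (fun i => (X c).1 i / P.1 i) : Fin (n + 1) → ℂ) r)

/-- The coefficient of the pullback `Ψ^* Ω` with respect to `ds_0 ∧ ⋯ ∧ ds_n`. -/
def pullbackOmega {n : ℕ} (Ψ : (Fin (n + 1) → ℝ) → Ambient n) (s : Fin (n + 1) → ℝ) : ℂ :=
  Omega (Ψ s) (fun b => fderiv ℝ Ψ s (Pi.single b 1))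

/-- The sign that compares the parameters `(η_1, …, η_{n-1})` with the orientation of `σ_e`, which
is the one for which `v_j ∧ or(σ_e)` is the standard orientation. -/
def orientationSign {d : ℕ} (vj : Fin (d + 1) → ℤ) (ξ : Fin d → Fin (d + 1) → ℤ) : ℤ :=
  Int.sign (Matrix.det (Matrix.of (Fin.cons vj ξ : Fin (d + 1) → Fin (d + 1) → ℤ)))

/-- The integral of `Ω` over the oriented singular fiber `SF_{x,e}`, the orientation being
`∂/∂θ_0 ∧ ∂/∂η_a ∧ or(σ_e)`. -/
def integralOnSingularFiber {d p : ℕ} (v : Fin p → Fin (d + 1) → ℤ) (lam : Fin p → ℝ)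
    (j : Fin p) (U : Set (Fin (d + 1) → ℝ)) (t : ℝ) (ρ : (Fin (d + 1) → ℝ) → ℝ)
    (γ : Fin (d + 1) → ℤ) (ξ : Fin d → Fin (d + 1) → ℤ) (x : Fin (d + 1) → ℝ) : ℂ :=
  (orientationSign (v j) ξ : ℂ) *
    ∫ s in cube (d + 2), pullbackOmega (singularFiber v lam j U t ρ γ ξ x) s

end TropicalPeriod

end

/-! ### Roots of a perturbed exponential equation. -/

noncomputable section

namespace TropicalPeriod

open Filter Topology

/-! Over a facet point `x`, put `ω = log t · τ|v_j|² + iα`. Since `χ_j(x) = 0`, `⟨v_j, γ⟩ = 1` and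
`ξ_k ⟂ v_j`, the `j`-th term of `W_Σ` at the point with parameters `(τ, α, η)` is exactly `e^ω`.
Thus `W_{Σ,j}` becomes `1 + e^ω` plus terms whose coefficients have modulus at most `t^{χ_k(x)}`
(`Wj_zPoint`), uniformly small because the `χ_k`, `k ≠ j`, have a positive lower bound on `U`. The
implicit function theorem at `ω = πi` and a compactness argument give one root in a fixed strip
(`exists_perturbed_root`).

The coefficients involve the unknown value of `ρ` at the root. The intermediate value theorem finds
a consistent value `r`, and constancy of `ρ` on `β_{x,amoeba}` makes `r` independent of `η`
(`exists_solution_map`). So `(τ, α)` is a periodic `C^1` function of `η`, and on the fiber `W_{Σ,j}`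
agrees with a Laurent polynomial with constant `r` in place of `ρ`. By uniqueness of `α` mod `2π` it
vanishes there only if `η_a` is a multiple of `2π`, so the singular points of the parametrization
lie on null faces of the cube.

Only `u` depends on `θ_0` in `Ω`, so `dlog u` contributes the factor `i` and its unbounded other
derivatives drop out. Writing `v_j = |v_j|²γ + ∑ e_l ξ_l`, the remaining determinant is `i^{d+1}
det(γ, ξ) (1 - i log t ∑ e_k ∂_kτ)` (`det_log_derivatives`). The last sum is a divergence of
periodic functions and integrates to zero, leaving `(2πi)^{d+2} det(γ, ξ)`.

Finally `γ` completes a basis of the lattice `v_j^⊥` to one of `ℤ^{d+1}`, so `|det(γ, ξ)|` is the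
integral volume of the dual cell (`edgeWeight_eq_abs_det`). Since `det(v_j, ξ) = |v_j|² det(γ, ξ)`,
the prescribed orientation removes the sign (`orientationSign_mul_det`). -/

/-- The equation `1 + e^ω = 0`, perturbed by real exponentials of `ω` with coefficients `A_k`. -/
def perturbedExp {ι : Type*} [Fintype ι] (b g : ι → ℝ) (P : (ι → ℂ) × ℂ) : ℂ :=
  1 + Complex.exp P.2 +
    ∑ k, P.1 k * Complex.exp (((b k * P.2.re : ℝ) : ℂ) + Complex.I * ((g k * P.2.im : ℝ) : ℂ))

lemma contDiff_perturbedExp {ι : Type*} [Fintype ι] (b g : ι → ℝ) :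
    ContDiff ℝ 1 (perturbedExp b g) := by
  have hre : ContDiff ℝ 1 (fun P : (ι → ℂ) × ℂ => P.2.re) :=
    Complex.reCLM.contDiff.comp contDiff_snd
  have him : ContDiff ℝ 1 (fun P : (ι → ℂ) × ℂ => P.2.im) :=
    Complex.imCLM.contDiff.comp contDiff_snd
  have hof : ContDiff ℝ 1 (fun x : ℝ => (x : ℂ)) := Complex.ofRealCLM.contDiff
  unfold perturbedExp
  refine (contDiff_const.add contDiff_snd.cexp).add (ContDiff.sum fun k _ => ?_)
  refine ContDiff.mul ((contDiff_apply ℝ ℂ k).comp contDiff_fst) (ContDiff.cexp ?_)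
  exact (hof.comp (contDiff_const.mul hre)).add
    (contDiff_const.mul (hof.comp (contDiff_const.mul him)))

lemma eq_pi_mul_I_of_one_add_exp_eq_zero {ω : ℂ} (h : 1 + Complex.exp ω = 0)
    (him : ω.im ∈ Icc 0 (2 * Real.pi)) : ω = Real.pi * Complex.I := by
  have h1 : Complex.exp ω = Complex.exp (Real.pi * Complex.I) := by
    rw [Complex.exp_pi_mul_I]; linear_combination h
  obtain ⟨n, hn⟩ := Complex.exp_eq_exp_iff_exists_int.1 h1
  have hi := congrArg Complex.im hn
  simp at hi
  have hpi := Real.pi_pos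
  have h0 : n = 0 := by
    have a1 : (n : ℝ) < 1 := by nlinarith [him.2]
    have a2 : (-1 : ℝ) < n := by nlinarith [him.1]
    have a3 : n < 1 := by exact_mod_cast a1
    have a4 : -1 < n := by exact_mod_cast a2
    omega
  simpa [h0] using hn

/-- For small coefficients `A`, the perturbed equation has exactly one root in the strip
`|re ω| ≤ 1`, `0 ≤ im ω < 2π`, and that root is a `C^1` function of `A`. -/
lemma exists_perturbed_root {ι : Type*} [Fintype ι] (b g : ι → ℝ) :
    ∃ ε > 0, ∃ φ : (ι → ℂ) → ℂ, ∀ A ∈ Metric.ball (0 : ι → ℂ) ε, ContDiffAt ℝ 1 φ A ∧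
      |(φ A).re| ≤ 1 ∧ (φ A).im ∈ Ico 0 (2 * Real.pi) ∧ perturbedExp b g (A, φ A) = 0 ∧
      ∀ ω : ℂ, |ω.re| ≤ 1 → ω.im ∈ Ico 0 (2 * Real.pi) → perturbedExp b g (A, ω) = 0 →
        ω = φ A := by
  have hpi := Real.pi_pos
  set ω₀ : ℂ := Real.pi * Complex.I with hω₀
  set u : (ι → ℂ) × ℂ := (0, ω₀) with hu
  have hcd := contDiff_perturbedExp b g
  have cdf : ContDiffAt ℝ 1 (perturbedExp b g) u := hcd.contDiffAt
  have hF0 : ∀ ω, perturbedExp b g (0, ω) = 1 + Complex.exp ω := fun ω => by simp [perturbedExp]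
  have hu0 : perturbedExp b g u = 0 := by rw [hu, hF0, hω₀, Complex.exp_pi_mul_I]; ring
  -- At `A = 0` the `ω`-derivative is `e^{πi} = -1`, hence invertible. Derivatives are taken over
  -- `ℝ` because the perturbation need not be holomorphic in `ω`: the exponents `b` and `g` may
  -- differ.
  have hder : (fderiv ℝ (perturbedExp b g) u ∘L .inr ℝ (ι → ℂ) ℂ) =
      ((ContinuousLinearEquiv.neg ℝ : ℂ ≃L[ℝ] ℂ) : ℂ →L[ℝ] ℂ) := by
    have h1 : HasFDerivAt (fun ω : ℂ => perturbedExp b g (0, ω))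
        (fderiv ℝ (perturbedExp b g) u ∘L .inr ℝ (ι → ℂ) ℂ) ω₀ := by
      have := (cdf.differentiableAt one_ne_zero).hasFDerivAt
      exact HasFDerivAt.comp (g := perturbedExp b g) (f := fun ω : ℂ => ((0 : ι → ℂ), ω))
        ω₀ this (hasFDerivAt_prodMk_right (𝕜 := ℝ) (0 : ι → ℂ) ω₀)
    have h2 : HasDerivAt (fun ω : ℂ => perturbedExp b g (0, ω)) (-1) ω₀ := by
      simp_rw [hF0]
      have := (Complex.hasDerivAt_exp ω₀).const_add 1
      rwa [hω₀, Complex.exp_pi_mul_I] at this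
    have h3 := h1.unique (h2.hasFDerivAt.restrictScalars ℝ)
    rw [h3]
    ext x; simp
  have if₂ : (fderiv ℝ (perturbedExp b g) u ∘L .inr ℝ (ι → ℂ) ℂ).IsInvertible :=
    ⟨_, hder.symm⟩
  set φ := cdf.implicitFunction one_ne_zero if₂ with hφ
  have e1 : ∀ᶠ A in 𝓝 (0 : ι → ℂ), perturbedExp b g (A, φ A) = 0 := by
    have := cdf.eventually_apply_implicitFunction one_ne_zero if₂
    rwa [hu0] at this
  have e2 : ∀ᶠ P in 𝓝 ((0 : ι → ℂ), ω₀), perturbedExp b g P = 0 → φ P.1 = P.2 := by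
    have := cdf.eventually_apply_eq_iff_implicitFunction one_ne_zero if₂
    rw [hu0] at this
    exact this.mono fun P h => h.1
  have hφ0 : φ 0 = ω₀ := cdf.implicitFunction_apply_self one_ne_zero if₂
  have cφ : ContDiffAt ℝ 1 φ 0 := cdf.contDiffAt_implicitFunction one_ne_zero if₂
  have e3 : ∀ᶠ A in 𝓝 (0 : ι → ℂ), ContDiffAt ℝ 1 φ A := cφ.eventually (by simp)
  have e4 : ∀ᶠ A in 𝓝 (0 : ι → ℂ), |(φ A).re| < 1 ∧ (φ A).im ∈ Ioo 0 (2 * Real.pi) := by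
    have hopen : IsOpen {ω : ℂ | |ω.re| < 1 ∧ ω.im ∈ Ioo 0 (2 * Real.pi)} :=
      (isOpen_lt (continuous_abs.comp Complex.continuous_re) continuous_const).and
        (isOpen_Ioo.preimage Complex.continuous_im)
    refine cφ.continuousAt.eventually_mem (hopen.mem_nhds ?_)
    rw [hφ0, hω₀]
    simp [hpi]
  rw [nhds_prod_eq] at e2
  obtain ⟨pa, ha, pb, hb, hab⟩ := Filter.eventually_prod_iff.1 e2
  obtain ⟨V, hVsub, hVo, hV⟩ := eventually_nhds_iff.1 hb
  -- The implicit function theorem gives uniqueness only inside `V`. On the rest of the rectangle `1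
  -- + e^ω` has no zero, and by compactness the tube lemma preserves this for all small `A`.
  set M : Set ℂ := (Icc (-1) 1 ×ℂ Icc 0 (2 * Real.pi)) \ V with hM
  have hMc : IsCompact M := (isCompact_Icc.reProdIm isCompact_Icc).diff hVo
  obtain ⟨S, T, hS, hT, h0S, hMT, hST⟩ := generalized_tube_lemma (isCompact_singleton (x := (0 : ι → ℂ)))
    hMc (n := {P | perturbedExp b g P ≠ 0}) (isOpen_ne_fun hcd.continuous continuous_const) (by
      rintro ⟨A, ω⟩ ⟨hA, hω⟩
      rw [mem_singleton_iff] at hA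
      simp only at hA hω
      subst hA
      intro h0
      rw [hF0] at h0
      apply hω.2
      rw [eq_pi_mul_I_of_one_add_exp_eq_zero h0 hω.1.2]
      exact hV)
  have e5 : ∀ᶠ A in 𝓝 (0 : ι → ℂ), A ∈ S := hS.mem_nhds (h0S rfl)
  obtain ⟨ε, hε, hball⟩ := Metric.eventually_nhds_iff_ball.1
    (e1.and (e3.and (e4.and (e5.and ha))))
  refine ⟨ε, hε, φ, fun A hA => ?_⟩
  obtain ⟨h1, h3, h4, h5, h6⟩ := hball A hA
  refine ⟨h3, h4.1.le, ⟨h4.2.1.le, h4.2.2⟩, h1, fun ω hre him h0 => ?_⟩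
  by_cases hωV : ω ∈ V
  · exact (hab h6 (hVsub ω hωV) h0).symm
  · exact absurd h0 (hST (mk_mem_prod h5 (hMT ⟨⟨abs_le.1 hre, him.1, him.2.le⟩, hωV⟩)))

end TropicalPeriod

end

/-! ### The integral volume of the dual cell. -/

noncomputable section

namespace TropicalPeriod

/-- Multiples of the top row do not matter, so the change of rows is block triangular with diagonal
blocks `1` and `C`. -/
lemma det_cons_combination {R : Type*} [CommRing R] {d : ℕ} (y : Fin (d + 1) → R)
    (B : Fin d → Fin (d + 1) → R) (c : Fin d → R) (C : Matrix (Fin d) (Fin d) R) :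
    Matrix.det (Matrix.of (Fin.cons y (fun k => c k • y + ∑ l, C k l • B l) :
        Fin (d + 1) → Fin (d + 1) → R)) =
      C.det * Matrix.det (Matrix.of (Fin.cons y B : Fin (d + 1) → Fin (d + 1) → R)) := by
  set Q : Matrix (Fin (d + 1)) (Fin (d + 1)) R :=
    Matrix.of (Fin.cons (Fin.cons 1 0) (fun k => Fin.cons (c k) (C k))) with hQ
  have h1 : Matrix.of (Fin.cons y (fun k => c k • y + ∑ l, C k l • B l) :
        Fin (d + 1) → Fin (d + 1) → R) =
      Q * Matrix.of (Fin.cons y B : Fin (d + 1) → Fin (d + 1) → R) := by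
    ext r s
    refine Fin.cases ?_ (fun k => ?_) r
    · simp [hQ, Matrix.mul_apply, Fin.sum_univ_succ]
    · simp [hQ, Matrix.mul_apply, Fin.sum_univ_succ, Finset.sum_apply]
  have h2 : Q.det = C.det := by
    rw [Matrix.det_succ_row_zero, Fin.sum_univ_succ]
    have : Q.submatrix Fin.succ Fin.succ = C := by ext r s; simp [hQ]
    simp [hQ] at this ⊢
    rw [this]
  rw [h1, Matrix.det_mul, h2]

lemma realVec_add {n : ℕ} (a b : Fin n → ℤ) : realVec (a + b) = realVec a + realVec b := by
  funext i; simp [realVec]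

lemma realVec_sum_smul {n : ℕ} {ι : Type*} (s : Finset ι) (c : ι → ℤ) (B : ι → Fin n → ℤ) :
    realVec (∑ i ∈ s, c i • B i) = ∑ i ∈ s, (c i : ℝ) • realVec (B i) := by
  funext r; simp [realVec, Finset.sum_apply]

lemma det_realVec {n : ℕ} (B : Fin n → Fin n → ℤ) :
    Matrix.det (Matrix.of fun k => realVec (B k)) = ((Matrix.det (Matrix.of B) : ℤ) : ℝ) := by
  rw [← eq_intCast (Int.castRingHom ℝ), RingHom.map_det]
  rfl

/-- The parallelotope with corner `q` and edge vectors `ξ_k`. -/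
def parallelotope {d n : ℕ} (q : Fin n → ℝ) (ξ : Fin d → Fin n → ℤ) : Set (Fin n → ℝ) :=
  {y | ∃ c ∈ Icc (0 : Fin d → ℝ) 1, y = q + ∑ k, c k • realVec (ξ k)}

lemma mixedCell_eq_parallelotope {d : ℕ} (f : Fin d → TropPoly (d + 1)) (a : Fin (d + 1) → ℝ)
    (q ξ : Fin d → Fin (d + 1) → ℤ)
    (h : ∀ k, (f k).dualCell a = segment ℝ (realVec (q k)) (realVec (q k + ξ k))) :
    mixedCell f a = parallelotope (∑ k, realVec (q k)) ξ := by
  have hseg : ∀ k x, x ∈ (f k).dualCell a ↔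
      ∃ c ∈ Icc (0 : ℝ) 1, x = realVec (q k) + c • realVec (ξ k) := fun k x => by
    rw [h, segment_eq_image', realVec_add]
    simp only [add_sub_cancel_left, mem_image, eq_comm]
  ext y
  constructor
  · rintro ⟨s, hs, rfl⟩
    choose c hc hc' using fun k => (hseg k _).1 (hs k)
    refine ⟨c, ⟨fun k => (hc k).1, fun k => (hc k).2⟩, ?_⟩
    rw [← Finset.sum_add_distrib]
    exact Finset.sum_congr rfl fun k _ => hc' k
  · rintro ⟨c, hc, rfl⟩
    refine ⟨fun k => realVec (q k) + c k • realVec (ξ k), fun k => (hseg k _).2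
      ⟨c k, ⟨hc.1 k, hc.2 k⟩, rfl⟩, ?_⟩
    rw [← Finset.sum_add_distrib]

lemma vectorSpan_parallelotope {d n : ℕ} (q : Fin n → ℝ) (ξ : Fin d → Fin n → ℤ) :
    vectorSpan ℝ (parallelotope q ξ) = Submodule.span ℝ (range fun k => realVec (ξ k)) := by
  apply le_antisymm
  · rw [vectorSpan_def, Submodule.span_le]
    rintro _ ⟨_, ⟨c, -, rfl⟩, _, ⟨c', -, rfl⟩, rfl⟩
    have : q + ∑ k, c k • realVec (ξ k) -ᵥ (q + ∑ k, c' k • realVec (ξ k)) =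
        ∑ k, (c k - c' k) • realVec (ξ k) := by
      simp [sub_smul, Finset.sum_sub_distrib]
    simp only [this]
    exact Submodule.sum_mem _ fun k _ =>
      Submodule.smul_mem _ _ (Submodule.subset_span (mem_range_self k))
  · rw [Submodule.span_le]
    rintro _ ⟨k, rfl⟩
    have h0 : q ∈ parallelotope q ξ := ⟨0, by simp, by simp⟩
    have h1 : q + realVec (ξ k) ∈ parallelotope q ξ := by
      refine ⟨Pi.single k 1, ⟨?_, ?_⟩, ?_⟩
      · exact Pi.single_nonneg.2 zero_le_one
      · intro l
        by_cases hl : l = k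
        · subst hl; simp
        · simp [hl]
      · simp [Pi.single_apply, ite_smul]
    simpa using vsub_mem_vectorSpan ℝ h1 h0

/-- A dimension count: the span lies in the kernel of pairing with `w`, which is onto because it
takes the value `1` at `γ`. Both spaces have dimension `d`. -/
lemma mem_span_iff_perp {d : ℕ} (w γ : Fin (d + 1) → ℤ) (ξ : Fin d → Fin (d + 1) → ℤ)
    (hγ : ∑ i, γ i * w i = 1) (hind : LinearIndependent ℝ (fun k => realVec (ξ k)))
    (hperp : ∀ k, ∑ i, w i * ξ k i = 0) (y : Fin (d + 1) → ℝ) :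
    y ∈ Submodule.span ℝ (range fun k => realVec (ξ k)) ↔ ∑ i, (w i : ℝ) * y i = 0 := by
  set ψ : (Fin (d + 1) → ℝ) →ₗ[ℝ] ℝ := Fintype.linearCombination ℝ (realVec w) with hψ
  have hψy : ∀ y, ψ y = ∑ i, (w i : ℝ) * y i := fun y => by
    simp [hψ, Fintype.linearCombination_apply, realVec, mul_comm]
  have hγ' : ψ (realVec γ) = 1 := by
    rw [hψy]
    have : ((∑ i, γ i * w i : ℤ) : ℝ) = 1 := by rw [hγ]; simp
    push_cast at this
    simpa [realVec, mul_comm] using this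
  have hsurj : LinearMap.range ψ = ⊤ := LinearMap.range_eq_top.2 fun c =>
    ⟨c • realVec γ, by rw [map_smul, hγ', smul_eq_mul, mul_one]⟩
  have hker := LinearMap.finrank_range_add_finrank_ker ψ
  rw [hsurj, finrank_top, Module.finrank_self, Module.finrank_fin_fun] at hker
  have hle : Submodule.span ℝ (range fun k => realVec (ξ k)) ≤ LinearMap.ker ψ := by
    rw [Submodule.span_le]
    rintro _ ⟨k, rfl⟩
    have : ((∑ i, w i * ξ k i : ℤ) : ℝ) = 0 := by rw [hperp k]; simp
    push_cast at this
    simpa [hψy, realVec] using this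
  have heq := Submodule.eq_of_le_of_finrank_eq hle (by
    rw [finrank_span_eq_card hind, Fintype.card_fin]; omega)
  rw [heq, LinearMap.mem_ker, hψy]

/-- Adding a vector of height one to a basis of the lattice of vectors of height zero gives a
basis of `ℤ^n`. -/
lemma exists_basis_cons {n r : ℕ} (w γ : Fin n → ℤ) (hγ : ∑ i, γ i * w i = 1)
    (L : Submodule ℤ (Fin n → ℤ)) (hL : ∀ m, m ∈ L ↔ ∑ i, w i * m i = 0)
    (B : Module.Basis (Fin r) ℤ L) :
    ∃ b : Module.Basis (Fin (r + 1)) ℤ (Fin n → ℤ),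
      (b : Fin (r + 1) → Fin n → ℤ) = Fin.cons γ (fun i => (B i : Fin n → ℤ)) := by
  have key : ∀ (c : ℤ) (x : Fin n → ℤ), ∑ i, w i * (x + c • γ) i = ∑ i, w i * x i + c := by
    intro c x
    have : ∑ i, w i * (x + c • γ) i = ∑ i, w i * x i + c * ∑ i, γ i * w i := by
      rw [Finset.mul_sum, ← Finset.sum_add_distrib]
      refine Finset.sum_congr rfl fun i _ => ?_
      simp; ring
    rw [this, hγ, mul_one]
  refine ⟨Module.Basis.mkFinCons γ B (fun c x hx h0 => ?_) (fun z => ?_),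
    Module.Basis.coe_mkFinCons _ _ _ _⟩
  · have := key c x
    rw [add_comm x, h0, (hL x).1 hx] at this
    simpa using this.symm
  · exact ⟨-∑ i, w i * z i, by rw [hL, key]; ring⟩

/-- In the coordinates given by `B`, the set is a translate of the image of the unit cube under the
transpose of `M`. The base point `q₀` affects only the translation. -/
lemma volume_preimage_parallelotope {d n : ℕ} (q q₀ : Fin n → ℝ) (ξ B : Fin d → Fin n → ℤ)
    (M : Matrix (Fin d) (Fin d) ℤ) (hM : ∀ k, ξ k = ∑ i, M k i • B i)
    (hB : LinearIndependent ℝ fun i => realVec (B i)) (hq₀ : q₀ ∈ parallelotope q ξ) :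
    volume.real {y : Fin d → ℝ | q₀ + ∑ i, y i • realVec (B i) ∈ parallelotope q ξ} =
      |((M.det : ℤ) : ℝ)| := by
  obtain ⟨c₀, -, rfl⟩ := hq₀
  set R : Matrix (Fin d) (Fin d) ℝ := M.map (Int.castRingHom ℝ) with hR
  set Λ : (Fin d → ℝ) →ₗ[ℝ] (Fin d → ℝ) := Matrix.toLin' R.transpose with hΛ
  have hcomb : ∀ c : Fin d → ℝ,
      ∑ k, c k • realVec (ξ k) = ∑ i, (Λ c) i • realVec (B i) := by
    intro c
    have h1 : ∀ k, c k • realVec (ξ k) = ∑ i, (c k * R k i) • realVec (B i) := fun k => by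
      rw [hM, realVec_sum_smul, Finset.smul_sum]
      simp [hR, smul_smul]
    simp_rw [h1]
    rw [Finset.sum_comm]
    refine Finset.sum_congr rfl fun i _ => ?_
    rw [← Finset.sum_smul]
    congr 1
    simp [hΛ, Matrix.mulVec, dotProduct, mul_comm]
  have hset : {y : Fin d → ℝ | q + ∑ k, c₀ k • realVec (ξ k) + ∑ i, y i • realVec (B i) ∈
      parallelotope q ξ} = (fun y => y + Λ c₀) ⁻¹' (Λ '' Icc 0 1) := by
    ext y
    simp only [parallelotope, mem_ofPred_eq, mem_preimage, mem_image]
    refine exists_congr fun c => and_congr_right fun _ => ?_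
    rw [add_assoc, add_right_inj, hcomb, hcomb, ← Finset.sum_add_distrib]
    simp_rw [← add_smul]
    constructor
    · intro h
      funext i
      have := Fintype.linearIndependent_iff.1 hB
        (fun i => (Λ c) i - ((Λ c₀) i + y i)) (by
          simp_rw [sub_smul]
          rw [Finset.sum_sub_distrib, h, sub_self]) i
      simp only [Pi.add_apply]
      linarith
    · intro h
      refine Finset.sum_congr rfl fun i _ => ?_
      rw [h, Pi.add_apply, add_comm]
  rw [hset, Measure.real, measure_preimage_add_right, Measure.addHaar_image_linearMap,
    Real.volume_Icc_pi, hΛ, LinearMap.det_toLin', Matrix.det_transpose, hR,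
    ← RingHom.mapMatrix_apply, ← RingHom.map_det]
  simp

/-- With `B` a basis of the lattice `w^⊥`, the determinant of `(γ, B)` is a unit. Expressing `ξ` in
`B` by a matrix `M` gives `det(γ, ξ) = ± det M`, and `|det M|` is the volume in the coordinates of
`B`. -/
lemma intVolume_parallelotope {d : ℕ} (w γ : Fin (d + 1) → ℤ) (ξ : Fin d → Fin (d + 1) → ℤ)
    (hγ : ∑ i, γ i * w i = 1) (hind : LinearIndependent ℝ (fun k => realVec (ξ k)))
    (hperp : ∀ k, ∑ i, w i * ξ k i = 0) (q : Fin (d + 1) → ℝ) :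
    intVolume (parallelotope q ξ) =
      |((Matrix.det (Matrix.of (Fin.cons γ ξ : Fin (d + 1) → Fin (d + 1) → ℤ)) : ℤ) : ℝ)| := by
  set S := parallelotope q ξ with hS
  have hL : ∀ m, m ∈ latticeOf S ↔ ∑ i, w i * m i = 0 := by
    intro m
    change realVec m ∈ vectorSpan ℝ S ↔ _
    rw [hS, vectorSpan_parallelotope, mem_span_iff_perp w γ ξ hγ hind hperp]
    simp only [realVec]
    exact_mod_cast Iff.rfl
  have hq₀ : Classical.epsilon (fun q : Fin (d + 1) → ℝ => q ∈ S) ∈ S :=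
    Classical.epsilon_spec (p := fun q : Fin (d + 1) → ℝ => q ∈ S) ⟨q, 0, by simp, by simp⟩
  unfold intVolume
  -- The origin and the lattice basis are arbitrary choices; only membership of the origin in `S`
  -- and the basis property are used below.
  generalize Classical.epsilon (fun q : Fin (d + 1) → ℝ => q ∈ S) = q₀ at hq₀ ⊢
  generalize Module.finBasis ℤ (latticeOf S) = B
  generalize Module.finrank ℤ (latticeOf S) = r at B
  obtain ⟨b, hb⟩ := exists_basis_cons w γ hγ _ hL B
  -- The rank of the parallel lattice is read off from the basis of `ℤ^{d+1}` with `r + 1` elements.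
  obtain rfl : r = d := by
    have := Module.finrank_eq_card_basis b
    rw [Module.finrank_fin_fun, Fintype.card_fin] at this
    omega
  have hunit := (Pi.basisFun ℤ (Fin (r + 1))).isUnit_det b
  rw [Pi.basisFun_det, hb] at hunit
  change IsUnit (Matrix.det (Matrix.of (Fin.cons γ fun i => (B i : Fin (r + 1) → ℤ)))) at hunit
  set M : Matrix (Fin r) (Fin r) ℤ := fun k i => B.repr ⟨ξ k, (hL _).2 (hperp k)⟩ i with hM
  have hξ : ∀ k, ξ k = ∑ i, M k i • (B i : Fin (r + 1) → ℤ) := fun k => by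
    have := congrArg (latticeOf S).subtype (B.sum_repr ⟨ξ k, (hL _).2 (hperp k)⟩)
    simp only [map_sum, map_smul, Submodule.subtype_apply] at this
    exact this.symm
  have hBind : LinearIndependent ℝ fun i => realVec (B i : Fin (r + 1) → ℤ) := by
    have h1 : LinearIndependent ℝ (Matrix.of fun k => realVec
        ((Fin.cons γ fun i => (B i : Fin (r + 1) → ℤ) : Fin (r + 1) → Fin (r + 1) → ℤ) k)).row := by
      rw [Matrix.linearIndependent_rows_iff_isUnit, Matrix.isUnit_iff_isUnit_det, det_realVec]
      exact hunit.map (Int.castRingHom ℝ)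
    exact h1.comp Fin.succ (Fin.succ_injective _)
  rw [volume_preimage_parallelotope q q₀ ξ _ M hξ hBind hq₀]
  have hdet := det_cons_combination γ (fun i => (B i : Fin (r + 1) → ℤ)) 0 M
  simp only [Pi.zero_apply, zero_smul, zero_add, ← hξ] at hdet
  rw [hdet]
  rcases Int.isUnit_iff.1 hunit with h | h <;> simp [h]

lemma edgeWeight_eq_abs_det {d p : ℕ} {v : Fin p → Fin (d + 1) → ℤ} {lam : Fin p → ℝ} {j : Fin p}
    {f : Fin d → TropPoly (d + 1)} {a : Fin (d + 1) → ℝ} {ξ : Fin d → Fin (d + 1) → ℤ}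
    (he : IsEdgeEnd v lam j f a ξ) (γ : Fin (d + 1) → ℤ) (hγ : ∑ i, γ i * v j i = 1) :
    edgeWeight f a =
      |((Matrix.det (Matrix.of (Fin.cons γ ξ : Fin (d + 1) → Fin (d + 1) → ℤ)) : ℤ) : ℝ)| := by
  choose q hq using he.cell
  rw [edgeWeight, mixedCell_eq_parallelotope f a q ξ hq,
    intVolume_parallelotope (v j) γ ξ hγ he.indep he.perp]

end TropicalPeriod

end

/-! ### The parametrized fiber for a given solution map, and integrals of periodic functions. -/

noncomputable section

namespace TropicalPeriod

lemma det_cons_smul_add {R : Type*} [CommRing R] {d : ℕ} (b : R) (y : Fin (d + 1) → R)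
    (B : Fin d → Fin (d + 1) → R) (e : Fin d → R) :
    Matrix.det (Matrix.of (Fin.cons (b • y + ∑ l, e l • B l) B : Fin (d + 1) → Fin (d + 1) → R)) =
      b * Matrix.det (Matrix.of (Fin.cons y B : Fin (d + 1) → Fin (d + 1) → R)) := by
  set Q : Matrix (Fin (d + 1)) (Fin (d + 1)) R :=
    Matrix.of (Fin.cons (Fin.cons b e) (fun k => Fin.cons 0 ((1 : Matrix (Fin d) (Fin d) R) k)))
    with hQ
  have h1 : Matrix.of (Fin.cons (b • y + ∑ l, e l • B l) B : Fin (d + 1) → Fin (d + 1) → R) =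
      Q * Matrix.of (Fin.cons y B : Fin (d + 1) → Fin (d + 1) → R) := by
    ext r s
    refine Fin.cases ?_ (fun k => ?_) r
    · simp [hQ, Matrix.mul_apply, Fin.sum_univ_succ, Finset.sum_apply]
    · simp [hQ, Matrix.mul_apply, Fin.sum_univ_succ, Matrix.one_apply]
  have h2 : Q.det = b := by
    rw [Matrix.det_succ_column_zero, Fin.sum_univ_succ]
    have : Q.submatrix Fin.succ Fin.succ = 1 := by ext r s; simp [hQ]
    simp [hQ] at this ⊢
    rw [this, Matrix.det_one, mul_one]
  rw [h1, Matrix.det_mul, h2]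

/-- The projection `(θ_0, η_a, η) ↦ η`. -/
def etaProj (d : ℕ) : (Fin (d + 2) → ℝ) →L[ℝ] (Fin d → ℝ) :=
  ContinuousLinearMap.pi fun k => ContinuousLinearMap.proj k.succ.succ

@[simp] lemma etaProj_apply {d : ℕ} (s : Fin (d + 2) → ℝ) (k : Fin d) :
    etaProj d s k = s k.succ.succ := rfl

lemma etaProj_update_zero {d : ℕ} (s : Fin (d + 2) → ℝ) (c : ℝ) :
    etaProj d (Function.update s 0 c) = etaProj d s := by
  ext k; simp

lemma etaProj_update_one {d : ℕ} (s : Fin (d + 2) → ℝ) (c : ℝ) :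
    etaProj d (Function.update s 1 c) = etaProj d s := by
  ext k
  rw [etaProj_apply, etaProj_apply, Function.update_of_ne]
  exact fun h => Fin.succ_ne_zero k (Fin.succ_injective _ (h.trans Fin.succ_zero_eq_one.symm))

lemma etaProj_update_succ_succ {d : ℕ} (s : Fin (d + 2) → ℝ) (k : Fin d) (c : ℝ) :
    etaProj d (Function.update s k.succ.succ c) = Function.update (etaProj d s) k c := by
  ext l
  by_cases h : l = k
  · subst h; simp
  · simp [h]

lemma etaProj_single_succ_succ {d : ℕ} (k : Fin d) :
    etaProj d (Pi.single k.succ.succ 1) = Pi.single k 1 := by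
  have := etaProj_update_succ_succ (0 : Fin (d + 2) → ℝ) k 1
  rwa [map_zero] at this

lemma etaProj_single_zero {d : ℕ} : etaProj d (Pi.single 0 1) = 0 := by
  have := etaProj_update_zero (0 : Fin (d + 2) → ℝ) 1
  rwa [map_zero] at this

lemma etaProj_single_one {d : ℕ} : etaProj d (Pi.single 1 1) = 0 := by
  have := etaProj_update_one (0 : Fin (d + 2) → ℝ) 1
  rwa [map_zero] at this

lemma isCompact_cube (m : ℕ) : IsCompact (cube m) := isCompact_Icc

/-- The integral over a period cube of a directional derivative of a periodic function vanishes. -/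
lemma integral_cube_fderiv_periodic {d : ℕ} (τ : (Fin d → ℝ) → ℝ) (hτ : ContDiff ℝ 1 τ)
    (hper : ∀ η k, τ (Function.update η k 0) = τ (Function.update η k (2 * Real.pi)))
    (e : Fin d → ℝ) :
    ∫ s in cube (d + 2), ∑ k, e k * fderiv ℝ τ (etaProj d s) (Pi.single k 1) = 0 := by
  -- The divergence theorem is applied on the full cube to the field `E · τ`. Its first two
  -- components vanish, so the faces in `θ_0` and `η_a` contribute nothing; the other opposite faces
  -- cancel by periodicity.
  set E : Fin (d + 2) → ℝ := Fin.cons 0 (Fin.cons 0 e) with hE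
  have hE0 : E 0 = 0 := by simp [hE]
  have hE1 : E (Fin.succ 0) = 0 := by simp [hE]
  have hEk : ∀ k : Fin d, E k.succ.succ = e k := fun k => by simp [hE]
  have hcont : Continuous fun s => fderiv ℝ τ (etaProj d s) :=
    (hτ.continuous_fderiv one_ne_zero).comp (etaProj d).continuous
  have hsum : ∀ s : Fin (d + 2) → ℝ,
      ∑ i, (E i • (fderiv ℝ τ (etaProj d s) ∘L etaProj d)) (Pi.single i 1) =
        ∑ k, e k * fderiv ℝ τ (etaProj d s) (Pi.single k 1) := by
    intro s
    rw [Fin.sum_univ_succ, Fin.sum_univ_succ, hE0, hE1]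
    simp [hEk, etaProj_single_succ_succ]
  have hdiv := integral_divergence_of_hasFDerivAt_off_countable'
    (fun _ : Fin (d + 2) => (0 : ℝ)) (fun _ => 2 * Real.pi) (fun _ => Real.two_pi_pos.le)
    (fun i s => E i * τ (etaProj d s)) (fun i s => E i • (fderiv ℝ τ (etaProj d s) ∘L etaProj d))
    ∅ countable_empty
    (fun i => (continuous_const.mul (hτ.continuous.comp (etaProj d).continuous)).continuousOn)
    (fun s _ i => by
      have h1 := (hτ.differentiable one_ne_zero (etaProj d s)).hasFDerivAt
      exact (h1.comp s (etaProj d).hasFDerivAt).const_mul (E i))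
    (by
      simp_rw [hsum]
      refine Continuous.integrableOn_Icc ?_
      exact continuous_finsetSum _ fun k _ =>
        continuous_const.mul (hcont.clm_apply continuous_const))
  simp_rw [hsum] at hdiv
  rw [cube, hdiv]
  refine Finset.sum_eq_zero fun i _ => ?_
  rw [sub_eq_zero]
  congr 1
  funext y
  refine Fin.cases ?_ (fun i => Fin.cases ?_ (fun k => ?_) i) i
  · simp [hE0]
  · simp [hE]
  · have h : ∀ c : ℝ, (k.succ.succ.insertNth c y : Fin (d + 2) → ℝ) =
        Function.update (k.succ.succ.insertNth 0 y : Fin (d + 2) → ℝ) k.succ.succ c :=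
      fun c => by rw [Fin.update_insertNth]
    change E _ * τ (etaProj d (k.succ.succ.insertNth (2 * Real.pi) y)) =
      E _ * τ (etaProj d (k.succ.succ.insertNth 0 y))
    rw [h (2 * Real.pi), h 0, etaProj_update_succ_succ, etaProj_update_succ_succ, hper,
      Function.update_idem]

variable {d : ℕ} (vj γ : Fin (d + 1) → ℤ) (ξ : Fin d → Fin (d + 1) → ℤ) (t : ℝ)
  (x : Fin (d + 1) → ℝ) (T : (Fin d → ℝ) → ℝ × ℝ)

/-- The `z`-component of the parametrization of the singular fiber, for a given solution map
`T = (τ, α)`. -/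
def fiberZ (s : Fin (d + 2) → ℝ) : Fin (d + 1) → ℂ :=
  zPoint vj γ ξ t x (T (etaProj d s)).1 ((T (etaProj d s)).2 + s 1) (etaProj d s)

/-- The parametrization of the singular fiber of `uv = g(z)`, for a given solution map `T`. -/
def fiberMap (g : (Fin (d + 1) → ℂ) → ℂ) (s : Fin (d + 2) → ℝ) : Ambient (d + 1) :=
  (fiberZ vj γ ξ t x T s,
    ((Real.sqrt ‖g (fiberZ vj γ ξ t x T s)‖ : ℝ) : ℂ) * Complex.exp (Complex.I * (s 0 : ℂ)),
    g (fiberZ vj γ ξ t x T s) / ((Real.sqrt ‖g (fiberZ vj γ ξ t x T s)‖ : ℝ) : ℂ) *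
      Complex.exp (-(Complex.I * (s 0 : ℂ))))

lemma zPoint_ne_zero (τ α : ℝ) (η : Fin d → ℝ) (i : Fin (d + 1)) :
    zPoint vj γ ξ t x τ α η i ≠ 0 := Complex.exp_ne_zero _

variable {T} in
lemma hasFDerivAt_fiberZ (hT : ContDiff ℝ 1 T) (s : Fin (d + 2) → ℝ) (i : Fin (d + 1)) :
    HasFDerivAt (fun s => fiberZ vj γ ξ t x T s i)
      (fiberZ vj γ ξ t x T s i •
        (Complex.ofRealCLM ∘L ((Real.log t * vj i) •
            (fderiv ℝ (fun η => (T η).1) (etaProj d s) ∘L etaProj d)) +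
          Complex.I • (Complex.ofRealCLM ∘L
            ((γ i : ℝ) • (fderiv ℝ (fun η => (T η).2) (etaProj d s) ∘L etaProj d +
              ContinuousLinearMap.proj 1) +
            ∑ k, (ξ k i : ℝ) • (ContinuousLinearMap.proj k ∘L etaProj d))))) s := by
  have h1 : HasFDerivAt (fun s => (T (etaProj d s)).1)
      (fderiv ℝ (fun η => (T η).1) (etaProj d s) ∘L etaProj d) s :=
    HasFDerivAt.comp s (f := etaProj d) (g := fun η => (T η).1)
      ((hT.fst.differentiable one_ne_zero) _).hasFDerivAt (etaProj d).hasFDerivAt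
  have h2 : HasFDerivAt (fun s => (T (etaProj d s)).2)
      (fderiv ℝ (fun η => (T η).2) (etaProj d s) ∘L etaProj d) s :=
    HasFDerivAt.comp s (f := etaProj d) (g := fun η => (T η).2)
      ((hT.snd.differentiable one_ne_zero) _).hasFDerivAt (etaProj d).hasFDerivAt
  have hP : HasFDerivAt (fun s => Real.log t * (x i + (T (etaProj d s)).1 * (vj i : ℝ)))
      ((Real.log t * vj i) •
            (fderiv ℝ (fun η => (T η).1) (etaProj d s) ∘L etaProj d)) s := by
    rw [← smul_smul]
    exact ((h1.mul_const (vj i : ℝ)).const_add (x i)).const_mul (Real.log t)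
  have hQ : HasFDerivAt (fun s : Fin (d + 2) → ℝ => ((T (etaProj d s)).2 + s 1) * (γ i : ℝ) +
      ∑ k, etaProj d s k * (ξ k i : ℝ))
      ((γ i : ℝ) • (fderiv ℝ (fun η => (T η).2) (etaProj d s) ∘L etaProj d +
              ContinuousLinearMap.proj 1) +
            ∑ k, (ξ k i : ℝ) • (ContinuousLinearMap.proj k ∘L etaProj d)) s := by
    refine ((h2.add (ContinuousLinearMap.proj (R := ℝ) (φ := fun _ : Fin (d + 2) => ℝ)
      1).hasFDerivAt).mul_const (γ i : ℝ)).add ?_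
    exact HasFDerivAt.fun_sum fun k _ => (((ContinuousLinearMap.proj (R := ℝ)
      (φ := fun _ : Fin d => ℝ) k) ∘L etaProj d).hasFDerivAt).mul_const _
  exact ((Complex.ofRealCLM.hasFDerivAt.comp s hP).add
    ((Complex.ofRealCLM.hasFDerivAt.comp s hQ).const_mul Complex.I)).cexp

variable {T} in
lemma differentiable_fiberZ (hT : ContDiff ℝ 1 T) : Differentiable ℝ (fiberZ vj γ ξ t x T) :=
  fun s => differentiableAt_pi.2 fun i => (hasFDerivAt_fiberZ vj γ ξ t x hT s i).differentiableAt

/-- The modulus is `√‖w‖`, which tends to `0` with `w`; division by zero supplies the matching value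
`0` at `w = 0`. This makes the `v`-coordinate continuous where `W_{Σ,j}` vanishes. -/
lemma continuous_div_sqrt_norm : Continuous fun w : ℂ => w / ((Real.sqrt ‖w‖ : ℝ) : ℂ) := by
  rw [continuous_iff_continuousAt]
  intro w
  have hs : Continuous fun w : ℂ => ((Real.sqrt ‖w‖ : ℝ) : ℂ) :=
    Complex.continuous_ofReal.comp (Real.continuous_sqrt.comp continuous_norm)
  by_cases hw : w = 0
  · subst hw
    rw [ContinuousAt, zero_div]
    refine squeeze_zero_norm (a := fun w : ℂ => Real.sqrt ‖w‖) (fun w => ?_) ?_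
    · rw [norm_div, Complex.norm_real, Real.norm_of_nonneg (Real.sqrt_nonneg _), Real.div_sqrt]
    · have : Continuous fun w : ℂ => Real.sqrt ‖w‖ := Real.continuous_sqrt.comp continuous_norm
      simpa using this.tendsto 0
  · refine continuousAt_id.div hs.continuousAt ?_
    simpa [Real.sqrt_eq_zero', not_le] using hw

variable {T} in
lemma differentiable_comp_fiberZ {g : (Fin (d + 1) → ℂ) → ℂ} (hT : ContDiff ℝ 1 T)
    (hg : ∀ z : Fin (d + 1) → ℂ, (∀ i, z i ≠ 0) → DifferentiableAt ℝ g z) :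
    Differentiable ℝ fun s => g (fiberZ vj γ ξ t x T s) :=
  fun s => (hg _ fun i => zPoint_ne_zero vj γ ξ t x _ _ _ i).comp s
    (differentiable_fiberZ vj γ ξ t x hT s)

variable {T} in
lemma continuous_fiberMap {g : (Fin (d + 1) → ℂ) → ℂ} (hT : ContDiff ℝ 1 T)
    (hg : ∀ z : Fin (d + 1) → ℂ, (∀ i, z i ≠ 0) → DifferentiableAt ℝ g z) :
    Continuous (fiberMap vj γ ξ t x T g) := by
  have hz := (differentiable_fiberZ vj γ ξ t x hT).continuous
  have hw := (differentiable_comp_fiberZ vj γ ξ t x hT hg).continuous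
  have h0 : Continuous fun s : Fin (d + 2) → ℝ => Complex.I * (s 0 : ℂ) :=
    continuous_const.mul (Complex.continuous_ofReal.comp (continuous_apply 0))
  refine hz.prodMk (Continuous.prodMk ?_ ?_)
  · exact (Complex.continuous_ofReal.comp (Real.continuous_sqrt.comp hw.norm)).mul h0.cexp
  · exact (continuous_div_sqrt_norm.comp hw).mul h0.neg.cexp

variable {T} in
lemma differentiableAt_fiberMap {g : (Fin (d + 1) → ℂ) → ℂ} (hT : ContDiff ℝ 1 T)
    (hg : ∀ z : Fin (d + 1) → ℂ, (∀ i, z i ≠ 0) → DifferentiableAt ℝ g z)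
    {s : Fin (d + 2) → ℝ} (hs : g (fiberZ vj γ ξ t x T s) ≠ 0) :
    DifferentiableAt ℝ (fiberMap vj γ ξ t x T g) s := by
  have hz := differentiable_fiberZ vj γ ξ t x hT s
  have hw := differentiable_comp_fiberZ vj γ ξ t x hT hg s
  have h0 : DifferentiableAt ℝ (fun s : Fin (d + 2) → ℝ => Complex.I * (s 0 : ℂ)) s :=
    (Complex.ofRealCLM.differentiableAt.comp s (differentiableAt_apply 0 s)).const_mul _
  have hq : DifferentiableAt ℝ
      (fun s => ((Real.sqrt ‖g (fiberZ vj γ ξ t x T s)‖ : ℝ) : ℂ)) s :=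
    Complex.ofRealCLM.differentiableAt.comp s ((hw.norm ℂ hs).sqrt (norm_ne_zero_iff.2 hs))
  refine hz.prodMk (DifferentiableAt.prodMk ?_ ?_)
  · exact hq.mul h0.cexp
  · have hne : ((Real.sqrt ‖g (fiberZ vj γ ξ t x T s)‖ : ℝ) : ℂ) ≠ 0 := by
      simpa [Real.sqrt_eq_zero', not_le] using hs
    simp_rw [div_eq_mul_inv]
    exact (hw.mul (hq.fun_inv hne)).mul h0.neg.cexp

end TropicalPeriod

end

/-! ### The pullback of `Ω` as a determinant. -/

noncomputable section

namespace TropicalPeriod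

lemma det_intCast {n : ℕ} (B : Fin n → Fin n → ℤ) :
    Matrix.det (Matrix.of fun k i => (B k i : ℂ)) = ((Matrix.det (Matrix.of B) : ℤ) : ℂ) := by
  rw [← eq_intCast (Int.castRingHom ℂ), RingHom.map_det]
  rfl

/-- The determinant of the logarithmic derivatives of `z` with respect to `(η_a, η)`. -/
lemma det_log_derivatives {d : ℕ} (vj γ : Fin (d + 1) → ℤ) (ξ : Fin d → Fin (d + 1) → ℤ)
    (N : ℝ) (e : Fin d → ℝ) (hv : ∀ i, (vj i : ℝ) = N * γ i + ∑ l, e l * ξ l i)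
    (A B : Fin d → ℝ) :
    Matrix.det (Matrix.of (Fin.cons (fun i => Complex.I * (γ i : ℂ))
      (fun k i => (A k : ℂ) * (vj i : ℂ) + Complex.I * ((B k : ℂ) * (γ i : ℂ) + (ξ k i : ℂ))) :
        Fin (d + 1) → Fin (d + 1) → ℂ)) =
      Complex.I ^ (d + 1) * (1 - Complex.I * ∑ k, (e k : ℂ) * (A k : ℂ)) *
        ((Matrix.det (Matrix.of (Fin.cons γ ξ : Fin (d + 1) → Fin (d + 1) → ℤ)) : ℤ) : ℂ) := by
  have hvC : ∀ i, (vj i : ℂ) = (N : ℂ) * γ i + ∑ l, (e l : ℂ) * ξ l i := fun i => by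
    have := congrArg (fun r : ℝ => (r : ℂ)) (hv i)
    push_cast at this
    exact this
  set G : Fin (d + 1) → ℂ := fun i => (γ i : ℂ) with hG
  set X : Fin d → Fin (d + 1) → ℂ := fun k i => (ξ k i : ℂ) with hX
  set y : Fin (d + 1) → ℂ := fun i => Complex.I * (γ i : ℂ) with hy
  -- After substituting for `v_j`, each lower row is a multiple of the top row plus `∑ C k l • X l`.
  -- The matrix `C` is `i` times a rank-one perturbation of the identity, so the matrix determinant
  -- lemma applies.
  set C : Matrix (Fin d) (Fin d) ℂ := Complex.I • (1 + Matrix.replicateCol Unit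
    (fun k => -(Complex.I * (A k : ℂ))) * Matrix.replicateRow Unit fun l => (e l : ℂ)) with hC
  set c : Fin d → ℂ := fun k => (B k : ℂ) - Complex.I * ((A k : ℂ) * N) with hc
  have hCkl : ∀ k l, C k l = Complex.I * (1 : Matrix (Fin d) (Fin d) ℂ) k l + A k * e l := by
    intro k l
    simp only [hC, Matrix.smul_apply, Matrix.add_apply, Matrix.mul_apply, Matrix.replicateCol_apply,
      Matrix.replicateRow_apply, Finset.univ_unique, Finset.sum_singleton, smul_eq_mul]
    linear_combination (-(A k : ℂ) * e l) * Complex.I_mul_I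
  have hrow : (fun (k : Fin d) i => (A k : ℂ) * (vj i : ℂ) +
      Complex.I * ((B k : ℂ) * (γ i : ℂ) + (ξ k i : ℂ))) =
      fun k => c k • y + ∑ l, C k l • X l := by
    funext k i
    simp only [Pi.add_apply, Pi.smul_apply, Finset.sum_apply, smul_eq_mul, hCkl, hvC, hy, hX, hc,
      add_mul, Finset.sum_add_distrib, mul_add, Finset.mul_sum]
    have h1 : ∑ l, Complex.I * (1 : Matrix (Fin d) (Fin d) ℂ) k l * (ξ l i : ℂ) =
        Complex.I * ξ k i := by
      simp [Matrix.one_apply]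
    rw [h1]
    simp only [mul_assoc]
    linear_combination ((A k : ℂ) * N * γ i) * Complex.I_mul_I
  have hdC : C.det = Complex.I ^ d * (1 - Complex.I * ∑ k, (e k : ℂ) * (A k : ℂ)) := by
    rw [hC, Matrix.det_smul, Fintype.card_fin, Matrix.det_one_add_replicateCol_mul_replicateRow]
    congr 1
    rw [dotProduct, sub_eq_add_neg, Finset.mul_sum, ← Finset.sum_neg_distrib]
    congr 1
    exact Finset.sum_congr rfl fun k _ => by ring
  have hy' : y = Complex.I • G + ∑ l, (0 : Fin d → ℂ) l • X l := by
    funext i; simp [hy, hG]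
  have hint : Matrix.det (Matrix.of (Fin.cons G X : Fin (d + 1) → Fin (d + 1) → ℂ)) =
      ((Matrix.det (Matrix.of (Fin.cons γ ξ : Fin (d + 1) → Fin (d + 1) → ℤ)) : ℤ) : ℂ) := by
    rw [← det_intCast]
    congr 1
    ext r i
    refine Fin.cases ?_ (fun k => ?_) r <;> simp [hG, hX]
  rw [hrow, det_cons_combination, hy', det_cons_smul_add, hdC, hint]
  ring

variable {d : ℕ} (vj γ : Fin (d + 1) → ℤ) (ξ : Fin d → Fin (d + 1) → ℤ) (t : ℝ)
  (x : Fin (d + 1) → ℝ) {T : (Fin d → ℝ) → ℝ × ℝ} {g : (Fin (d + 1) → ℂ) → ℂ}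

lemma fiberZ_add_smul_single_zero (s : Fin (d + 2) → ℝ) (h : ℝ) :
    fiberZ vj γ ξ t x T (s + h • Pi.single 0 1) = fiberZ vj γ ξ t x T s := by
  unfold fiberZ
  rw [map_add, map_smul, etaProj_single_zero, smul_zero, add_zero]
  simp

/-- The derivative of `u` in the direction of `θ_0`. -/
lemma fderiv_fiberMap_u (s : Fin (d + 2) → ℝ)
    (hd : DifferentiableAt ℝ (fiberMap vj γ ξ t x T g) s) :
    (fderiv ℝ (fiberMap vj γ ξ t x T g) s (Pi.single 0 1)).2.1 =
      Complex.I * (fiberMap vj γ ξ t x T g s).2.1 := by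
  have h1 := (hd.hasFDerivAt.snd.fst).hasLineDerivAt (Pi.single 0 1)
  have h2 : HasDerivAt (fun h : ℝ =>
      (fiberMap vj γ ξ t x T g (s + h • (Pi.single 0 1 : Fin (d + 2) → ℝ))).2.1)
      (Complex.I * (fiberMap vj γ ξ t x T g s).2.1) 0 := by
    have h3 : HasDerivAt (fun h : ℝ => (s 0 : ℂ) + (h : ℂ)) 1 0 :=
      (Complex.ofRealCLM.hasDerivAt (x := (0 : ℝ))).const_add _
    have h4 := (((h3.const_mul Complex.I).cexp).const_mul
      ((Real.sqrt ‖g (fiberZ vj γ ξ t x T s)‖ : ℝ) : ℂ))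
    have h5 : (fun h : ℝ =>
        (fiberMap vj γ ξ t x T g (s + h • (Pi.single 0 1 : Fin (d + 2) → ℝ))).2.1) =
        fun h : ℝ => ((Real.sqrt ‖g (fiberZ vj γ ξ t x T s)‖ : ℝ) : ℂ) *
          Complex.exp (Complex.I * ((s 0 : ℂ) + (h : ℂ))) := by
      funext h
      simp only [fiberMap, fiberZ_add_smul_single_zero]
      simp
    rw [h5]
    refine h4.congr_deriv ?_
    simp only [fiberMap, Complex.ofReal_zero, add_zero]
    ring
  exact HasDerivAt.unique h1 h2

lemma fderiv_fiberMap_z (hT : ContDiff ℝ 1 T) (s : Fin (d + 2) → ℝ)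
    (hd : DifferentiableAt ℝ (fiberMap vj γ ξ t x T g) s) (b : Fin (d + 2) → ℝ)
    (i : Fin (d + 1)) :
    (fderiv ℝ (fiberMap vj γ ξ t x T g) s b).1 i / (fiberMap vj γ ξ t x T g s).1 i =
      ((Real.log t * fderiv ℝ (fun η => (T η).1) (etaProj d s) (etaProj d b) : ℝ) : ℂ) * vj i +
        Complex.I * (((fderiv ℝ (fun η => (T η).2) (etaProj d s) (etaProj d b) + b 1 : ℝ) : ℂ) *
          γ i + ∑ k, (b k.succ.succ : ℂ) * ξ k i) := by
  have h1 := hasFDerivAt_pi'.1 hd.hasFDerivAt.fst i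
  have h2 := congrArg (fun F => F b) (h1.unique (hasFDerivAt_fiberZ vj γ ξ t x hT s i))
  have h3 : (fderiv ℝ (fiberMap vj γ ξ t x T g) s b).1 i =
    fiberZ vj γ ξ t x T s i * (((Real.log t * vj i *
      fderiv ℝ (fun η => (T η).1) (etaProj d s) (etaProj d b) : ℝ) : ℂ) +
      Complex.I * (((γ i : ℝ) * (fderiv ℝ (fun η => (T η).2) (etaProj d s) (etaProj d b) + b 1) +
        ∑ k, (ξ k i : ℝ) * b k.succ.succ : ℝ) : ℂ)) := by
    refine h2.trans ?_
    simp
    ring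
  have h0 : fiberZ vj γ ξ t x T s i ≠ 0 := zPoint_ne_zero vj γ ξ t x _ _ _ i
  rw [h3, show (fiberMap vj γ ξ t x T g s).1 i = fiberZ vj γ ξ t x T s i from rfl,
    mul_div_cancel_left₀ _ h0]
  push_cast
  have h4 : ∀ k, (b k.succ.succ : ℂ) * ξ k i = ξ k i * b k.succ.succ := fun k => mul_comm _ _
  simp_rw [h4]
  ring

/-- The coordinate `z` does not depend on `θ_0`, so the first column has the single nonzero entry
`i`. Expanding along it removes all other derivatives of `log u` and leaves the determinant of the
logarithmic derivatives of `z`. -/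
lemma pullbackOmega_fiberMap (hT : ContDiff ℝ 1 T) (N : ℝ) (e : Fin d → ℝ)
    (hv : ∀ i, (vj i : ℝ) = N * γ i + ∑ l, e l * ξ l i) (s : Fin (d + 2) → ℝ)
    (hd : DifferentiableAt ℝ (fiberMap vj γ ξ t x T g) s)
    (hu : (fiberMap vj γ ξ t x T g s).2.1 ≠ 0) :
    pullbackOmega (fiberMap vj γ ξ t x T g) s =
      Complex.I ^ (d + 2) *
        ((Matrix.det (Matrix.of (Fin.cons γ ξ : Fin (d + 1) → Fin (d + 1) → ℤ)) : ℤ) : ℂ) *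
      (1 - Complex.I * ((Real.log t * ∑ k, e k *
        fderiv ℝ (fun η => (T η).1) (etaProj d s) (Pi.single k 1) : ℝ) : ℂ)) := by
  have hz := fderiv_fiberMap_z vj γ ξ t x (g := g) hT s hd
  unfold pullbackOmega Omega
  rw [Matrix.det_succ_column_zero, Fin.sum_univ_succ]
  have hzero : ∀ i : Fin (d + 1), (fderiv ℝ (fiberMap vj γ ξ t x T g) s (Pi.single 0 1)).1 i /
      (fiberMap vj γ ξ t x T g s).1 i = 0 := fun i => by
    rw [hz, etaProj_single_zero]; simp
  rw [Finset.sum_eq_zero fun i _ => by simp [hzero i], add_zero]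
  have hminor : ((Matrix.of fun r c : Fin (d + 1 + 1) => (Fin.cons
      ((fderiv ℝ (fiberMap vj γ ξ t x T g) s (Pi.single c 1)).2.1 /
        (fiberMap vj γ ξ t x T g s).2.1)
      (fun i => (fderiv ℝ (fiberMap vj γ ξ t x T g) s (Pi.single c 1)).1 i /
        (fiberMap vj γ ξ t x T g s).1 i) : Fin (d + 1 + 1) → ℂ) r).submatrix
          (Fin.succAbove 0) Fin.succ) =
      (Matrix.of (Fin.cons (fun i => Complex.I * (γ i : ℂ)) (fun k i =>
        ((Real.log t * fderiv ℝ (fun η => (T η).1) (etaProj d s) (Pi.single k 1) : ℝ) : ℂ) *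
          (vj i : ℂ) + Complex.I *
            (((fderiv ℝ (fun η => (T η).2) (etaProj d s) (Pi.single k 1) : ℝ) : ℂ) * (γ i : ℂ) +
              (ξ k i : ℂ))) : Fin (d + 1) → Fin (d + 1) → ℂ)).transpose := by
    ext i c
    refine Fin.cases ?_ (fun k => ?_) c
    · simp only [Matrix.submatrix_apply, Matrix.of_apply, Fin.succAbove_zero, Fin.cons_succ, hz,
        Matrix.transpose_apply, Fin.cons_zero]
      rw [show (Fin.succ 0 : Fin (d + 2)) = 1 from rfl, etaProj_single_one]
      have : ∀ k : Fin d, (Pi.single 1 1 : Fin (d + 2) → ℝ) k.succ.succ = 0 := fun k => by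
        have := congrFun (etaProj_single_one (d := d)) k
        exact this
      simp [this]
    · simp only [Matrix.submatrix_apply, Matrix.of_apply, Fin.succAbove_zero, Fin.cons_succ, hz,
        Matrix.transpose_apply, etaProj_single_succ_succ]
      have h1 : (Pi.single k.succ.succ 1 : Fin (d + 2) → ℝ) 1 = 0 :=
        Pi.single_eq_of_ne (fun h => Fin.succ_ne_zero k
          (Fin.succ_injective _ (h.symm.trans Fin.succ_zero_eq_one.symm))) _
      have h2 : ∀ l : Fin d, (Pi.single k.succ.succ 1 : Fin (d + 2) → ℝ) l.succ.succ =
          (Pi.single k 1 : Fin d → ℝ) l := fun l => by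
        rw [← etaProj_single_succ_succ (d := d)]; rfl
      simp [h1, h2, Pi.single_apply, apply_ite]
  rw [hminor, Matrix.det_transpose, det_log_derivatives vj γ ξ N e hv]
  simp only [Matrix.of_apply, Fin.cons_zero, fderiv_fiberMap_u vj γ ξ t x s hd]
  rw [mul_div_cancel_right₀ _ hu]
  push_cast
  rw [Finset.mul_sum, Finset.mul_sum, Finset.mul_sum]
  simp only [Fin.val_zero, pow_zero]
  have : ∀ k : Fin d, Complex.I * ((e k : ℂ) * ((Real.log t : ℂ) *
      (fderiv ℝ (fun η => (T η).1) (etaProj d s) (Pi.single k 1) : ℂ))) =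
      Complex.I * ((Real.log t : ℂ) * ((e k : ℂ) *
      (fderiv ℝ (fun η => (T η).1) (etaProj d s) (Pi.single k 1) : ℂ))) := fun k => by ring
  simp_rw [this]
  rw [← Finset.mul_sum]
  ring

end TropicalPeriod

end

/-! ### Periodicity of the fiber map and the integral over the cube. -/

noncomputable section

namespace TropicalPeriod

/-- The phases enter only modulo `2π` in each coordinate, and integrality of `γ` and `ξ` turns
period shifts of `α` and `η` into such multiples. -/
lemma zPoint_congr_of_phase {d : ℕ} (vj γ : Fin (d + 1) → ℤ) (ξ : Fin d → Fin (d + 1) → ℤ) (t : ℝ)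
    (x : Fin (d + 1) → ℝ) (τ α α' : ℝ) (η η' : Fin d → ℝ) (m : Fin (d + 1) → ℤ)
    (h : ∀ i, α' * (γ i : ℝ) + ∑ k, η' k * (ξ k i : ℝ) =
      α * (γ i : ℝ) + ∑ k, η k * (ξ k i : ℝ) + m i * (2 * Real.pi)) :
    zPoint vj γ ξ t x τ α' η' = zPoint vj γ ξ t x τ α η := by
  funext i
  refine Complex.exp_eq_exp_iff_exists_int.2 ⟨m i, ?_⟩
  rw [h i]
  push_cast
  ring

lemma zPoint_add_int_mul_two_pi {d : ℕ} (vj γ : Fin (d + 1) → ℤ) (ξ : Fin d → Fin (d + 1) → ℤ)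
    (t : ℝ) (x : Fin (d + 1) → ℝ) (τ α : ℝ) (η : Fin d → ℝ) (m : ℤ) :
    zPoint vj γ ξ t x τ (α + m * (2 * Real.pi)) η = zPoint vj γ ξ t x τ α η :=
  zPoint_congr_of_phase vj γ ξ t x τ _ _ _ _ (fun i => m * γ i) fun i => by push_cast; ring

lemma zPoint_update_two_pi {d : ℕ} (vj γ : Fin (d + 1) → ℤ) (ξ : Fin d → Fin (d + 1) → ℤ)
    (t : ℝ) (x : Fin (d + 1) → ℝ) (τ α : ℝ) (η : Fin d → ℝ) (k : Fin d) :
    zPoint vj γ ξ t x τ α (Function.update η k (2 * Real.pi)) =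
      zPoint vj γ ξ t x τ α (Function.update η k 0) := by
  refine zPoint_congr_of_phase vj γ ξ t x τ _ _ _ _ (ξ k) fun i => ?_
  have : ∀ l, Function.update η k (2 * Real.pi) l * (ξ l i : ℝ) =
      Function.update η k 0 l * (ξ l i : ℝ) + if l = k then (ξ k i : ℝ) * (2 * Real.pi) else 0 := by
    intro l
    by_cases hl : l = k
    · subst hl; simp; ring
    · simp [hl]
  simp_rw [this, Finset.sum_add_distrib]
  simp [add_assoc]

/-- The boundary of the cube is null; in particular the faces `η_a = 0` and `η_a = 2π`, where `u`
may vanish, can be ignored. -/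
lemma ae_cube_of_forall {d : ℕ} {P : (Fin (d + 2) → ℝ) → Prop}
    (h : ∀ s : Fin (d + 2) → ℝ, 0 < s 1 → s 1 < 2 * Real.pi → P s) :
    ∀ᵐ s ∂(volume.restrict (cube (d + 2))), P s := by
  have h1 := Measure.univ_pi_Ioo_ae_eq_Icc (μ := fun _ : Fin (d + 2) => (volume : Measure ℝ))
    (f := fun _ => 0) (g := fun _ => 2 * Real.pi)
  rw [← volume_pi] at h1
  rw [cube, ← Measure.restrict_congr_set h1]
  refine ae_restrict_of_forall_mem (MeasurableSet.univ_pi fun _ => measurableSet_Ioo)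
    fun s hs => h s (hs 1 (mem_univ _)).1 (hs 1 (mem_univ _)).2

section fiberMap

variable {d : ℕ} (vj γ : Fin (d + 1) → ℤ) (ξ : Fin d → Fin (d + 1) → ℤ) (t : ℝ)
  (x : Fin (d + 1) → ℝ) {T : (Fin d → ℝ) → ℝ × ℝ} {g : (Fin (d + 1) → ℂ) → ℂ}

lemma fiberMap_update_two_pi
    (hper : ∀ η k, T (Function.update η k 0) = T (Function.update η k (2 * Real.pi)))
    (s : Fin (d + 2) → ℝ) (b : Fin (d + 2)) :
    fiberMap vj γ ξ t x T g (Function.update s b 0) =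
      fiberMap vj γ ξ t x T g (Function.update s b (2 * Real.pi)) := by
  have hz : fiberZ vj γ ξ t x T (Function.update s b 0) =
      fiberZ vj γ ξ t x T (Function.update s b (2 * Real.pi)) := by
    unfold fiberZ
    refine Fin.cases ?_ (fun b => Fin.cases ?_ (fun k => ?_) b) b
    · rw [etaProj_update_zero, etaProj_update_zero, Function.update_of_ne (by simp),
        Function.update_of_ne (by simp)]
    · rw [Fin.succ_zero_eq_one, etaProj_update_one, etaProj_update_one, Function.update_self,
        Function.update_self]
      have := zPoint_add_int_mul_two_pi vj γ ξ t x (T (etaProj d s)).1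
        ((T (etaProj d s)).2 + 0) (etaProj d s) 1
      rw [← this]
      simp
    · have h1 : (1 : Fin (d + 2)) ≠ k.succ.succ := fun h => Fin.succ_ne_zero k
        (Fin.succ_injective _ (h.symm.trans Fin.succ_zero_eq_one.symm))
      rw [etaProj_update_succ_succ, etaProj_update_succ_succ, Function.update_of_ne h1,
        Function.update_of_ne h1, ← hper, zPoint_update_two_pi]
  have h0 : Complex.exp (Complex.I * (Function.update s b 0 0 : ℝ)) =
      Complex.exp (Complex.I * (Function.update s b (2 * Real.pi) 0 : ℝ)) := by
    by_cases hb : (0 : Fin (d + 2)) = b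
    · subst hb
      simp only [Function.update_self]
      refine Complex.exp_eq_exp_iff_exists_int.2 ⟨-1, ?_⟩
      push_cast; ring
    · rw [Function.update_of_ne hb, Function.update_of_ne hb]
  unfold fiberMap
  rw [hz, Complex.exp_neg, Complex.exp_neg, h0]

lemma fiberMap_u_ne_zero {s : Fin (d + 2) → ℝ} (hs : g (fiberZ vj γ ξ t x T s) ≠ 0) :
    (fiberMap vj γ ξ t x T g s).2.1 ≠ 0 := by
  refine mul_ne_zero ?_ (Complex.exp_ne_zero _)
  simpa [Real.sqrt_eq_zero', not_le] using hs

lemma fiberMap_u_mul_v (s : Fin (d + 2) → ℝ) :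
    (fiberMap vj γ ξ t x T g s).2.1 * (fiberMap vj γ ξ t x T g s).2.2 =
      g (fiberZ vj γ ξ t x T s) := by
  unfold fiberMap
  simp only
  generalize g (fiberZ vj γ ξ t x T s) = w
  by_cases hw : w = 0
  · simp [hw]
  · have h0 : ((Real.sqrt ‖w‖ : ℝ) : ℂ) ≠ 0 := by simpa [Real.sqrt_eq_zero', not_le] using hw
    rw [Complex.exp_neg]
    have h1 := Complex.exp_ne_zero (Complex.I * (s 0 : ℂ))
    field_simp

/-- Integrability of the pullback of `Ω`, and its integral. -/
lemma integral_pullbackOmega_fiberMap (hT : ContDiff ℝ 1 T)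
    (hg : ∀ z : Fin (d + 1) → ℂ, (∀ i, z i ≠ 0) → DifferentiableAt ℝ g z)
    (hper : ∀ η k, T (Function.update η k 0) = T (Function.update η k (2 * Real.pi)))
    (hne : ∀ s : Fin (d + 2) → ℝ, 0 < s 1 → s 1 < 2 * Real.pi → g (fiberZ vj γ ξ t x T s) ≠ 0)
    (N : ℝ) (e : Fin d → ℝ) (hv : ∀ i, (vj i : ℝ) = N * γ i + ∑ l, e l * ξ l i) :
    IntegrableOn (pullbackOmega (fiberMap vj γ ξ t x T g)) (cube (d + 2)) ∧
      ∫ s in cube (d + 2), pullbackOmega (fiberMap vj γ ξ t x T g) s =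
        (2 * (Real.pi : ℂ) * Complex.I) ^ (d + 2) *
          ((Matrix.det (Matrix.of (Fin.cons γ ξ : Fin (d + 1) → Fin (d + 1) → ℤ)) : ℤ) : ℂ) := by
  set D : ℂ := ((Matrix.det (Matrix.of (Fin.cons γ ξ : Fin (d + 1) → Fin (d + 1) → ℤ)) : ℤ) : ℂ)
  set R : (Fin (d + 2) → ℝ) → ℝ := fun s => ∑ k, e k *
        fderiv ℝ (fun η => (T η).1) (etaProj d s) (Pi.single k 1) with hR
  have hRc : Continuous R := continuous_finsetSum _ fun k _ => continuous_const.mul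
    (((hT.fst.continuous_fderiv one_ne_zero).comp (etaProj d).continuous).clm_apply
      continuous_const)
  have hR0 : ∫ s in cube (d + 2), R s = 0 :=
    integral_cube_fderiv_periodic (fun η => (T η).1) hT.fst
      (fun η k => congrArg Prod.fst (hper η k)) e
  have hae : pullbackOmega (fiberMap vj γ ξ t x T g) =ᵐ[volume.restrict (cube (d + 2))]
      fun s => Complex.I ^ (d + 2) * D * (1 - Complex.I * ((Real.log t * R s : ℝ) : ℂ)) :=
    ae_cube_of_forall fun s h0 h1 => pullbackOmega_fiberMap vj γ ξ t x hT N e hv s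
      (differentiableAt_fiberMap vj γ ξ t x hT hg (hne s h0 h1))
      (fiberMap_u_ne_zero vj γ ξ t x (hne s h0 h1))
  have hc2 : Continuous fun s => Complex.I * ((Real.log t * R s : ℝ) : ℂ) :=
    continuous_const.mul (Complex.continuous_ofReal.comp (continuous_const.mul hRc))
  have hcont : Continuous fun s =>
      Complex.I ^ (d + 2) * D * (1 - Complex.I * ((Real.log t * R s : ℝ) : ℂ)) :=
    continuous_const.mul (continuous_const.sub hc2)
  refine ⟨(hcont.continuousOn.integrableOn_compact (isCompact_cube _)).congr hae.symm, ?_⟩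
  rw [integral_congr_ae hae, integral_const_mul, integral_sub
    (continuous_const.continuousOn.integrableOn_compact (isCompact_cube _))
    (hc2.continuousOn.integrableOn_compact (isCompact_cube _)), integral_const_mul,
    integral_complex_ofReal, integral_const_mul, hR0]
  have hvol : volume.real (cube (d + 2)) = (2 * Real.pi) ^ (d + 2) := by
    rw [cube, Measure.real, Real.volume_Icc_pi_toReal (fun _ => Real.two_pi_pos.le)]
    simp
  rw [setIntegral_const, hvol]
  simp only [mul_zero, Complex.ofReal_zero, sub_zero, Complex.real_smul, mul_one]
  push_cast
  ring

end fiberMap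

end TropicalPeriod

end

/-! ### The function `W_{Σ,j}` over a facet point, and its solution map. -/

noncomputable section

namespace TropicalPeriod

open Filter Topology

variable {d p : ℕ} (v : Fin p → Fin (d + 1) → ℤ) (lam : Fin p → ℝ) (j : Fin p)
  (γ : Fin (d + 1) → ℤ) (ξ : Fin d → Fin (d + 1) → ℤ)

/-- The squared length of an integral vector. -/
def sqLength {n : ℕ} (w : Fin n → ℤ) : ℝ := ∑ i, (w i : ℝ) * (w i : ℝ)

lemma sqLength_pos {n : ℕ} {w γ : Fin n → ℤ} (hγ : ∑ i, γ i * w i = 1) : 0 < sqLength w := by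
  refine lt_of_le_of_ne (Finset.sum_nonneg fun i _ => mul_self_nonneg _) fun h => ?_
  have h0 := (Finset.sum_eq_zero_iff_of_nonneg fun i _ => mul_self_nonneg ((w i : ℝ))).1 h.symm
  have : ∀ i, w i = 0 := fun i => by simpa using h0 i (Finset.mem_univ i)
  simp [this] at hγ

lemma LogT_zPoint (vj : Fin (d + 1) → ℤ) {t : ℝ} (ht : Real.log t ≠ 0) (x : Fin (d + 1) → ℝ)
    (τ α : ℝ) (η : Fin d → ℝ) :
    LogT t (zPoint vj γ ξ t x τ α η) = x + τ • realVec vj := by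
  funext i
  simp only [LogT, zPoint, Complex.norm_exp]
  rw [Real.log_exp]
  simp [realVec, ht]

lemma chi_add_smul (k : Fin p) (x : Fin (d + 1) → ℝ) (τ : ℝ) (w : Fin (d + 1) → ℤ) :
    chi v lam k (x + τ • realVec w) =
      chi v lam k x + τ * ∑ i, (v k i : ℝ) * (w i : ℝ) := by
  simp only [chi, Pi.add_apply, Pi.smul_apply, smul_eq_mul, realVec, mul_add,
    Finset.sum_add_distrib, Finset.mul_sum, add_assoc]
  congr 2
  exact Finset.sum_congr rfl fun i _ => by ring

lemma monomial_zPoint (m vj : Fin (d + 1) → ℤ) (t : ℝ) (x : Fin (d + 1) → ℝ) (τ α : ℝ)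
    (η : Fin d → ℝ) :
    monomial m (zPoint vj γ ξ t x τ α η) =
      Complex.exp (((Real.log t * ∑ i, (m i : ℝ) * (x i + τ * vj i) : ℝ) : ℂ) +
        Complex.I * ((α * ∑ i, (m i : ℝ) * γ i +
          ∑ k, η k * ∑ i, (m i : ℝ) * ξ k i : ℝ) : ℂ)) := by
  simp only [monomial, zPoint]
  simp_rw [← Complex.exp_int_mul]
  rw [← Complex.exp_sum]
  congr 1
  push_cast
  simp only [mul_add, Finset.sum_add_distrib, Finset.mul_sum]
  rw [Finset.sum_comm (s := (Finset.univ : Finset (Fin d)))]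
  simp only [← Finset.sum_add_distrib]
  refine Finset.sum_congr rfl fun i _ => ?_
  have h : ∀ k, Complex.I * ((η k : ℂ) * ((m i : ℂ) * (ξ k i : ℂ))) =
      (m i : ℂ) * (Complex.I * ((η k : ℂ) * (ξ k i : ℂ))) := fun k => by ring
  simp_rw [h]
  ring

/-- The term `t^{λ_k} z^{v_k}` at a point of the fiber. -/
lemma term_zPoint (k : Fin p) (vj : Fin (d + 1) → ℤ) {t : ℝ} (ht : 0 < t) (x : Fin (d + 1) → ℝ)
    (τ α : ℝ) (η : Fin d → ℝ) :
    ((t ^ lam k : ℝ) : ℂ) * monomial (v k) (zPoint vj γ ξ t x τ α η) =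
      ((t ^ chi v lam k x : ℝ) : ℂ) *
        Complex.exp (Complex.I * ((∑ l, η l * ∑ i, (v k i : ℝ) * ξ l i : ℝ) : ℂ)) *
        Complex.exp (((Real.log t * (τ * ∑ i, (v k i : ℝ) * vj i) : ℝ) : ℂ) +
          Complex.I * (((∑ i, (v k i : ℝ) * γ i) * α : ℝ) : ℂ)) := by
  rw [monomial_zPoint, Real.rpow_def_of_pos ht, Real.rpow_def_of_pos ht, Complex.ofReal_exp,
    Complex.ofReal_exp, ← Complex.exp_add, ← Complex.exp_add, ← Complex.exp_add]
  congr 1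
  have : ∑ i, (v k i : ℝ) * (x i + τ * vj i) =
      ∑ i, (v k i : ℝ) * x i + τ * ∑ i, (v k i : ℝ) * vj i := by
    rw [Finset.mul_sum, ← Finset.sum_add_distrib]
    exact Finset.sum_congr rfl fun i _ => by ring
  rw [this, chi]
  push_cast
  ring

/-- The coefficients of the perturbation of `1 + e^ω` that is given by `W_{Σ,j}` on the fiber,
when the cut-off function has the value `r`. -/
def perturbCoeff (t : ℝ) (x : Fin (d + 1) → ℝ) (r : ℝ) (η : Fin d → ℝ) (k : Fin p) : ℂ :=
  if k = j then 0 else ((1 - r : ℝ) : ℂ) * (((t ^ chi v lam k x : ℝ) : ℂ) *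
    Complex.exp (Complex.I * ((∑ l, η l * ∑ i, (v k i : ℝ) * ξ l i : ℝ) : ℂ)))

/-- The real exponents of the perturbation. -/
def perturbRe (k : Fin p) : ℝ := (∑ i, (v k i : ℝ) * v j i) / sqLength (v j)

/-- The imaginary exponents of the perturbation. -/
def perturbIm (k : Fin p) : ℝ := ∑ i, (v k i : ℝ) * γ i

/-- The `j`-th term is `e^ω`, by `χ_j(x) = 0`, `⟨v_j, γ⟩ = 1` and `ξ_l ⟂ v_j`. Each other term is
multiplied by `1 - ρ`, and its dependence on `τ` is rewritten through `re ω = log t · τ|v_j|²`. -/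
lemma Wj_zPoint (hγ : ∑ i, γ i * v j i = 1) (hperp : ∀ k, ∑ i, v j i * ξ k i = 0) {t : ℝ}
    (ht : 0 < t) (ht1 : Real.log t ≠ 0) {x : Fin (d + 1) → ℝ} (hx : chi v lam j x = 0)
    (ρ : (Fin (d + 1) → ℝ) → ℝ) (τ α : ℝ) (η : Fin d → ℝ) :
    Wj v lam j t ρ (zPoint (v j) γ ξ t x τ α η) =
      perturbedExp (perturbRe v j) (perturbIm v γ)
        (perturbCoeff v lam j ξ t x (ρ (x + τ • realVec (v j))) η,
          ⟨Real.log t * (τ * sqLength (v j)), α⟩) := by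
  have hS := (sqLength_pos hγ).ne'
  have hsplit : ∀ F : Fin p → ℂ, ∑ k, F k = F j + ∑ k ∈ Finset.univ.filter (fun k => k ≠ j), F k :=
    fun F => by
      rw [Finset.filter_ne', Finset.add_sum_erase _ _ (Finset.mem_univ j)]
  have hg : (∑ i, (v j i : ℝ) * γ i) = 1 := by
    have : ((∑ i, γ i * v j i : ℤ) : ℝ) = 1 := by rw [hγ]; simp
    push_cast at this
    simpa [mul_comm] using this
  have hp : ∀ l, (∑ i, (v j i : ℝ) * ξ l i) = 0 := fun l => by
    have : ((∑ i, v j i * ξ l i : ℤ) : ℝ) = 0 := by rw [hperp]; simp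
    push_cast at this
    exact this
  unfold Wj W perturbedExp
  rw [LogT_zPoint γ ξ (v j) ht1, hsplit, hsplit]
  simp_rw [term_zPoint v lam γ ξ _ (v j) ht]
  rw [hx, hg]
  simp_rw [hp]
  generalize ρ (x + τ • realVec (v j)) = r
  have hω : (⟨Real.log t * (τ * sqLength (v j)), α⟩ : ℂ) =
      ((Real.log t * (τ * sqLength (v j)) : ℝ) : ℂ) + Complex.I * ((1 * α : ℝ) : ℂ) := by
    apply Complex.ext <;> simp
  have hj : perturbCoeff v lam j ξ t x r η j = 0 := by simp [perturbCoeff]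
  rw [hj, zero_mul, zero_add, hω]
  simp only [sqLength, mul_zero, Finset.sum_const_zero, Real.rpow_zero, Complex.ofReal_zero,
    Complex.exp_zero, Complex.ofReal_one, one_mul]
  have hsum : ∀ F G : Fin p → ℂ, (∀ k, k ≠ j → F k - r * F k = G k) → ∀ c : ℂ,
      c + ∑ k ∈ Finset.univ.filter (fun k => k ≠ j), F k -
        r * ∑ k ∈ Finset.univ.filter (fun k => k ≠ j), F k =
      c + ∑ k ∈ Finset.univ.filter (fun k => k ≠ j), G k := by
    intro F G h c
    rw [add_sub_assoc, Finset.mul_sum, ← Finset.sum_sub_distrib]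
    congr 1
    exact Finset.sum_congr rfl fun k hk => h k (Finset.mem_filter.1 hk).2
  rw [← add_assoc]
  apply hsum
  intro k hk
  have he : Real.log t * (τ * ∑ i, (v k i : ℝ) * v j i) =
      perturbRe v j k * (Real.log t * (τ * sqLength (v j))) := by
    unfold perturbRe; field_simp
  rw [he, perturbCoeff, if_neg hk]
  simp only [perturbIm, sqLength]
  simp
  ring

lemma norm_perturbCoeff_le {t : ℝ} (ht : 0 < t) (x : Fin (d + 1) → ℝ) {r : ℝ}
    (hr : r ∈ Icc (0 : ℝ) 1) (η : Fin d → ℝ) {k : Fin p} (hk : k ≠ j) :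
    ‖perturbCoeff v lam j ξ t x r η k‖ ≤ t ^ chi v lam k x := by
  rw [perturbCoeff, if_neg hk, norm_mul, norm_mul, Complex.norm_real, Complex.norm_real,
    mul_comm Complex.I, Complex.norm_exp_ofReal_mul_I, mul_one,
    Real.norm_of_nonneg (Real.rpow_nonneg ht.le _)]
  refine mul_le_of_le_one_left (Real.rpow_nonneg ht.le _) ?_
  rw [Real.norm_eq_abs, abs_le]
  constructor <;> linarith [hr.1, hr.2]

lemma continuous_perturbCoeff (t : ℝ) (x : Fin (d + 1) → ℝ) (η : Fin d → ℝ) :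
    Continuous fun r => perturbCoeff v lam j ξ t x r η := by
  refine continuous_pi fun k => ?_
  unfold perturbCoeff
  split_ifs
  · exact continuous_const
  · exact (Complex.continuous_ofReal.comp (continuous_const.sub continuous_id)).mul
      continuous_const

lemma contDiff_perturbCoeff (t : ℝ) (x : Fin (d + 1) → ℝ) (r : ℝ) :
    ContDiff ℝ 1 fun η => perturbCoeff v lam j ξ t x r η := by
  refine contDiff_pi.2 fun k => ?_
  unfold perturbCoeff
  split_ifs
  · exact contDiff_const
  · refine contDiff_const.mul (contDiff_const.mul (ContDiff.cexp (contDiff_const.mul ?_)))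
    have h1 : ContDiff ℝ 1 fun η : Fin d → ℝ => ∑ l, η l * ∑ i, (v k i : ℝ) * ξ l i :=
      ContDiff.sum fun l _ => (contDiff_apply ℝ ℝ l).mul contDiff_const
    exact Complex.ofRealCLM.contDiff.comp h1

/-- The hypothesis confines `e^{re ω}` to `[1/2, 3/2]`, which lies inside `[1/e, e]`. -/
lemma abs_le_one_of_norm_one_add_exp_le {ω : ℂ} (h : ‖1 + Complex.exp ω‖ ≤ 1 / 2) :
    |ω.re| ≤ 1 := by
  have h1 : |Real.exp ω.re - 1| ≤ 1 / 2 := by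
    have := abs_norm_sub_norm_le (Complex.exp ω) (-1)
    rw [Complex.norm_exp, norm_neg, norm_one, sub_neg_eq_add, add_comm _ (1 : ℂ)] at this
    exact this.trans h
  have h2 := abs_le.1 h1
  have h3 := Real.exp_one_gt_d9
  rw [abs_le]
  constructor
  · rw [← Real.exp_le_exp, Real.exp_neg]
    have : (Real.exp 1)⁻¹ ≤ 1 / 2 := by
      rw [inv_le_comm₀ (Real.exp_pos 1) (by norm_num)]; linarith
    linarith
  · rw [← Real.exp_le_exp]; linarith

/-- A zero of `W_{Σ,j}` over a point of `U` corresponds to a root in the strip `|re ω| ≤ 1`. -/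
lemma abs_re_le_one_of_perturbedExp_eq_zero {t c : ℝ} (ht : 0 < t) (ht1 : t < 1)
    (hp : p * t ^ c ≤ 1 / 2) (hγ : ∑ i, γ i * v j i = 1) (x : Fin (d + 1) → ℝ) {r : ℝ}
    (hr : r ∈ Icc (0 : ℝ) 1) (η : Fin d → ℝ) (τ α : ℝ)
    (hU : ∀ k, k ≠ j → c ≤ chi v lam k (x + τ • realVec (v j)))
    (h0 : perturbedExp (perturbRe v j) (perturbIm v γ) (perturbCoeff v lam j ξ t x r η,
      ⟨Real.log t * (τ * sqLength (v j)), α⟩) = 0) :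
    |Real.log t * (τ * sqLength (v j))| ≤ 1 := by
  have hS := (sqLength_pos hγ).ne'
  refine abs_le_one_of_norm_one_add_exp_le
    (ω := ⟨Real.log t * (τ * sqLength (v j)), α⟩) ?_
  unfold perturbedExp at h0
  rw [eq_neg_of_add_eq_zero_left h0, norm_neg]
  refine (norm_sum_le _ _).trans (le_trans (Finset.sum_le_card_nsmul _ _ (t ^ c) ?_) ?_)
  · intro k _
    by_cases hk : k = j
    · subst hk
      simpa [perturbCoeff] using Real.rpow_nonneg ht.le c
    · rw [norm_mul, Complex.norm_exp]
      refine (mul_le_mul_of_nonneg_right (norm_perturbCoeff_le v lam j ξ ht x hr η hk)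
        (Real.exp_pos _).le).trans ?_
      -- The growth in `re ω` is exactly the change of `χ_k` from `x` to `x + τ v_j`, so the bound
      -- `c ≤ χ_k` at the shifted point controls the whole term.
      have : t ^ chi v lam k x * Real.exp
          (perturbRe v j k * (Real.log t * (τ * sqLength (v j)))) =
          t ^ chi v lam k (x + τ • realVec (v j)) := by
        rw [chi_add_smul, Real.rpow_def_of_pos ht, Real.rpow_def_of_pos ht, ← Real.exp_add]
        congr 1
        unfold perturbRe
        field_simp
      simp only [Complex.add_re, Complex.ofReal_re, Complex.mul_re, Complex.I_re, Complex.I_im,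
        Complex.ofReal_im, mul_zero, zero_mul, sub_zero, add_zero]
      rw [this]
      exact Real.rpow_le_rpow_of_exponent_ge ht ht1.le (hU k hk)
  · simpa using hp

variable {v lam j}

/-- For a fixed small `t`, the solutions `(τ_x(η), α_x(η))` are given by a `C^1` map, and the
cut-off function is constant along it. -/
lemma exists_solution_map (N : FacetNeighborhoods v lam j) (hγ : ∑ i, γ i * v j i = 1)
    (hperp : ∀ k, ∑ i, v j i * ξ k i = 0) {ε c δ t : ℝ} {φ : (Fin p → ℂ) → ℂ}
    (hφ : ∀ A ∈ Metric.ball (0 : Fin p → ℂ) ε, ContDiffAt ℝ 1 φ A ∧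
      |(φ A).re| ≤ 1 ∧ (φ A).im ∈ Ico 0 (2 * Real.pi) ∧
      perturbedExp (perturbRe v j) (perturbIm v γ) (A, φ A) = 0 ∧
      ∀ ω : ℂ, |ω.re| ≤ 1 → ω.im ∈ Ico 0 (2 * Real.pi) →
        perturbedExp (perturbRe v j) (perturbIm v γ) (A, ω) = 0 → ω = φ A)
    (hc : ∀ y ∈ N.U, ∀ k, k ≠ j → c ≤ chi v lam k y) (ht : 0 < t) (ht1 : t < 1)
    (hp : p * t ^ c ≤ 1 / 2) (htε : t ^ c < ε) (htδ : 1 < δ * (-Real.log t * sqLength (v j)))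
    {ρ : (Fin (d + 1) → ℝ) → ℝ} (hρ : IsCutoff N t ρ) {x : Fin (d + 1) → ℝ}
    (hx : x ∈ N.U ∩ facet v lam j) (hδ : ∀ r : ℝ, |r| < δ → x + r • realVec (v j) ∈ N.U) :
    ∃ (T : (Fin d → ℝ) → ℝ × ℝ) (r : ℝ), ContDiff ℝ 1 T ∧
      (∀ η s, IsSolution v lam j N.U t ρ γ ξ x η s ↔ s = T η) ∧
      ∀ η, ρ (x + (T η).1 • realVec (v j)) = r := by
  have hS := sqLength_pos hγ
  have hlog : Real.log t < 0 := Real.log_neg ht ht1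
  -- The factor converting `τ` to `re ω`. A root with `|re ω| ≤ 1` has `|τ| ≤ 1/|κ| < δ`, which
  -- keeps `x + τ v_j` in `U`.
  set κ : ℝ := Real.log t * sqLength (v j) with hκ
  have hκ0 : κ < 0 := mul_neg_of_neg_of_pos hlog hS
  have hWj := Wj_zPoint v lam j γ ξ hγ hperp ht hlog.ne hx.2.2 ρ
  have hκτ : ∀ τ, Real.log t * (τ * sqLength (v j)) = κ * τ := fun τ => by rw [hκ]; ring
  have hA : ∀ r ∈ Icc (0 : ℝ) 1, ∀ η,
      perturbCoeff v lam j ξ t x r η ∈ Metric.ball (0 : Fin p → ℂ) ε := by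
    intro r hr η
    rw [mem_ball_zero_iff]
    refine lt_of_le_of_lt ((pi_norm_le_iff_of_nonneg (Real.rpow_nonneg ht.le c)).2
      fun k => ?_) htε
    by_cases hk : k = j
    · subst hk
      simpa [perturbCoeff] using Real.rpow_nonneg ht.le c
    · exact (norm_perturbCoeff_le v lam j ξ ht x hr η hk).trans
        (Real.rpow_le_rpow_of_exponent_ge ht ht1.le (hc x hx.1 k hk))
  set Φ : ℝ → (Fin d → ℝ) → ℂ := fun r η => φ (perturbCoeff v lam j ξ t x r η) with hΦ
  have hmemU : ∀ r ∈ Icc (0 : ℝ) 1, ∀ η,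
      x + ((Φ r η).re / κ) • realVec (v j) ∈ N.U := by
    intro r hr η
    refine hδ _ ?_
    have h1 := (hφ _ (hA r hr η)).2.1
    rw [abs_div, div_lt_iff₀ (abs_pos.2 hκ0.ne), abs_of_neg hκ0]
    refine lt_of_le_of_lt h1 ?_
    rw [hκ]
    linarith
  have hsolves : ∀ η, ∀ r ∈ Icc (0 : ℝ) 1, ρ (x + ((Φ r η).re / κ) • realVec (v j)) = r →
      IsSolution v lam j N.U t ρ γ ξ x η ((Φ r η).re / κ, (Φ r η).im) := by
    intro η r hr hrρ
    have h := hφ _ (hA r hr η)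
    have h0 : Wj v lam j t ρ (zPoint (v j) γ ξ t x ((Φ r η).re / κ) (Φ r η).im η) = 0 := by
      rw [hWj, hrρ, hκτ, mul_div_cancel₀ _ hκ0.ne]
      exact h.2.2.2.1
    refine ⟨h.2.2.1, ⟨⟨⟨_, rfl⟩, hmemU r hr η⟩, _, ⟨fun i => ?_, h0⟩, ?_⟩, h0⟩
    · exact zPoint_ne_zero (v j) γ ξ t x _ _ _ i
    · exact LogT_zPoint γ ξ (v j) hlog.ne x _ _ _
  -- A self-consistent cut-off value: prescribing `r` determines a root and hence a point, where `ρ`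
  -- must again equal `r`. As `ρ` takes values in `[0, 1]`, the difference changes sign between `r =
  -- 0` and `r = 1`.
  have hexists : ∀ η, ∃ r ∈ Icc (0 : ℝ) 1, ρ (x + ((Φ r η).re / κ) • realVec (v j)) = r := by
    intro η
    have hcont : ContinuousOn (fun r => ρ (x + ((Φ r η).re / κ) • realVec (v j)) - r)
        (Icc 0 1) := by
      have h1 : ContinuousOn (fun r => Φ r η) (Icc 0 1) := fun r hr =>
        (ContinuousAt.comp (f := fun r => perturbCoeff v lam j ξ t x r η)
          (hφ _ (hA r hr η)).1.continuousAt
          (continuous_perturbCoeff v lam j ξ t x η).continuousAt).continuousWithinAt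
      refine ContinuousOn.sub (hρ.smooth.continuous.comp_continuousOn ?_) continuousOn_id
      exact continuousOn_const.add
        (((Complex.continuous_re.comp_continuousOn h1).div_const κ).smul continuousOn_const)
    have := intermediate_value_Icc' zero_le_one hcont
    obtain ⟨r, hr, h0⟩ := this (a := 0)
      ⟨by linarith [(hρ.mem_Icc (x + ((Φ 1 η).re / κ) • realVec (v j))).2],
        by linarith [(hρ.mem_Icc (x + ((Φ 0 η).re / κ) • realVec (v j))).1]⟩
    exact ⟨r, hr, by linarith⟩
  -- The value found at `η = 0` serves for every `η`: all the points so obtained lie in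
  -- `β_{x,amoeba}`, where `ρ` is constant.
  obtain ⟨r, hr, hr0⟩ := hexists 0
  have hbeta0 := (hsolves 0 r hr hr0).2.1
  have hconst : ∀ y ∈ betaAmoeba v lam j N.U t ρ x, ρ y = r := fun y hy => by
    rw [hρ.const_on x hx y hy _ hbeta0]; exact hr0
  have hval : ∀ η, ρ (x + ((Φ r η).re / κ) • realVec (v j)) = r := by
    intro η
    obtain ⟨r', hr', h'⟩ := hexists η
    have := hconst _ (hsolves η r' hr' h').2.1
    rw [h'] at this
    rwa [this] at h'
  refine ⟨fun η => ((Φ r η).re / κ, (Φ r η).im), r, ?_, fun η s => ⟨fun hs => ?_, ?_⟩, hval⟩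
  · have h1 : ContDiff ℝ 1 (Φ r) := contDiff_iff_contDiffAt.2 fun η =>
      (hφ _ (hA r hr η)).1.comp η (contDiff_perturbCoeff v lam j ξ t x r).contDiffAt
    exact ((Complex.reCLM.contDiff.comp h1).div_const κ).prodMk (Complex.imCLM.contDiff.comp h1)
  · obtain ⟨hα, hβ, h0⟩ := hs
    have hρr := hconst _ hβ
    rw [hWj, hρr] at h0
    -- Uniqueness in the strip suffices, because any zero lying over `U` satisfies `|re ω| ≤ 1`.
    have h1 := (hφ _ (hA r hr η)).2.2.2.2 ⟨Real.log t * (s.1 * sqLength (v j)), s.2⟩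
      (abs_re_le_one_of_perturbedExp_eq_zero v lam j γ ξ ht ht1 hp hγ x hr η s.1 s.2
        (hc _ hβ.1.2) h0) hα h0
    have h2 := congrArg Complex.re h1
    have h3 := congrArg Complex.im h1
    simp only [hκτ] at h2 h3
    refine Prod.ext ?_ h3
    rw [eq_div_iff hκ0.ne, mul_comm]
    exact h2
  · rintro rfl
    exact hsolves η r hr (hval η)

end TropicalPeriod

end

/-! ### Choice of the parameter, orientation, and identification of the singular fiber. -/

noncomputable section

namespace TropicalPeriod

open Filter Topology

lemma exists_uniform_gap {n p : ℕ} {v : Fin p → Fin n → ℤ} {lam : Fin p → ℝ} {j : Fin p}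
    (N : FacetNeighborhoods v lam j) {a : Fin n → ℝ} (ha : a ∈ N.U ∩ facet v lam j) :
    ∃ c : ℝ, 0 < c ∧ ∀ y ∈ N.U, ∀ k, k ≠ j → c ≤ chi v lam k y := by
  obtain ⟨c, hc, hU⟩ := N.gap
  -- The constant `c_j` bounds all other `χ_k` from below on `U`, and it is positive because `χ_j(a)
  -- = 0 < c_j`.
  refine ⟨c j, ?_, fun y hy k hk => ((hc k hk).trans ((hU y hy).2 k hk)).le⟩
  have := (hU a ha.1).1
  rwa [ha.2.2] at this

/-- The bound `p t^c ≤ 1/2` forces zeros over `U` into the strip, `t^c < ε` puts the coefficients in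
the ball of the implicit function, and the last inequality keeps the root over `U`. -/
lemma exists_small_parameter {c ε δ S : ℝ} (p : ℕ) (hc : 0 < c) (hε : 0 < ε) (hδ : 0 < δ)
    (hS : 0 < S) :
    ∃ t₀ : ℝ, 0 < t₀ ∧ ∀ t : ℝ, 0 < t → t < t₀ →
      t < 1 ∧ p * t ^ c ≤ 1 / 2 ∧ t ^ c < ε ∧ 1 < δ * (-Real.log t * S) := by
  have h1 : Tendsto (fun t : ℝ => t ^ c) (𝓝[>] 0) (𝓝 0) := by
    have := (Real.continuousAt_rpow_const 0 c (Or.inr hc.le)).tendsto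
    rw [Real.zero_rpow hc.ne'] at this
    exact this.mono_left nhdsWithin_le_nhds
  have h2 : Tendsto (fun t : ℝ => p * t ^ c) (𝓝[>] 0) (𝓝 0) := by
    simpa using h1.const_mul (p : ℝ)
  have e1 : ∀ᶠ t : ℝ in 𝓝[>] 0, t < 1 :=
    nhdsWithin_le_nhds (Iio_mem_nhds one_pos)
  have e2 := h2.eventually (Iic_mem_nhds (show (0 : ℝ) < 1 / 2 by norm_num))
  have e3 := h1.eventually (Iio_mem_nhds hε)
  have e4 := Real.tendsto_log_nhdsGT_zero.eventually (eventually_lt_atBot (-(1 / (δ * S))))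
  obtain ⟨t₀, ht₀, hsub⟩ := mem_nhdsGT_iff_exists_Ioo_subset.1 (e1.and (e2.and (e3.and e4)))
  refine ⟨t₀, ht₀, fun t h0 ht => ?_⟩
  obtain ⟨k1, k2, k3, k4⟩ := hsub ⟨h0, ht⟩
  refine ⟨k1, k2, k3, ?_⟩
  have h5 : 1 / (δ * S) < -Real.log t := by linarith
  rw [div_lt_iff₀ (mul_pos hδ hS)] at h5
  linarith

/-- `W_{Σ,j}` with the value `r` in place of the cut-off function. -/
def WjConst {n p : ℕ} (v : Fin p → Fin n → ℤ) (lam : Fin p → ℝ) (j : Fin p) (t r : ℝ)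
    (z : Fin n → ℂ) : ℂ :=
  Wj v lam j t (fun _ => r) z

lemma differentiableAt_WjConst {n p : ℕ} (v : Fin p → Fin n → ℤ) (lam : Fin p → ℝ) (j : Fin p)
    (t r : ℝ) (z : Fin n → ℂ) (hz : ∀ i, z i ≠ 0) :
    DifferentiableAt ℝ (WjConst v lam j t r) z := by
  have hm : ∀ m : Fin n → ℤ, DifferentiableAt ℝ (monomial m) z := fun m => by
    have h1 : ∀ i, DifferentiableAt ℂ (fun z : Fin n → ℂ => z i ^ m i) z := fun i =>
      DifferentiableAt.comp (g := fun w : ℂ => w ^ m i) (f := fun z : Fin n → ℂ => z i) z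
        (differentiableAt_zpow.2 (Or.inl (hz i))) (differentiableAt_apply i z)
    exact (HasFDerivAt.finsetProd fun i _ =>
      (h1 i).hasFDerivAt).differentiableAt.restrictScalars ℝ
  unfold WjConst Wj W
  refine DifferentiableAt.sub ((differentiableAt_const _).add
    (DifferentiableAt.fun_sum fun k _ => (hm _).const_mul _)) ?_
  exact (DifferentiableAt.fun_sum fun k _ => (hm _).const_mul _).const_mul _

/-- The vector `w - |w|²γ` is orthogonal to `w`, because `⟨w, γ⟩ = 1`, hence lies in the span of the
`ξ_l`. -/
lemma exists_coordinates {d : ℕ} (w γ : Fin (d + 1) → ℤ) (ξ : Fin d → Fin (d + 1) → ℤ)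
    (hγ : ∑ i, γ i * w i = 1) (hind : LinearIndependent ℝ (fun k => realVec (ξ k)))
    (hperp : ∀ k, ∑ i, w i * ξ k i = 0) :
    ∃ e : Fin d → ℝ, ∀ i, (w i : ℝ) = sqLength w * γ i + ∑ l, e l * ξ l i := by
  have hg : (∑ i, (w i : ℝ) * γ i) = 1 := by
    have : ((∑ i, γ i * w i : ℤ) : ℝ) = 1 := by rw [hγ]; simp
    push_cast at this
    simpa [mul_comm] using this
  have h := (mem_span_iff_perp w γ ξ hγ hind hperp (realVec w - sqLength w • realVec γ)).2 (by
    simp only [Pi.sub_apply, Pi.smul_apply, realVec, smul_eq_mul, mul_sub, Finset.sum_sub_distrib]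
    have : ∑ i, (w i : ℝ) * (sqLength w * γ i) = sqLength w * ∑ i, (w i : ℝ) * γ i := by
      rw [Finset.mul_sum]
      exact Finset.sum_congr rfl fun i _ => by ring
    rw [this, hg, mul_one, sqLength, sub_self])
  obtain ⟨e, he⟩ := (Submodule.mem_span_range_iff_exists_fun ℝ).1 h
  refine ⟨e, fun i => ?_⟩
  have := congrFun he i
  simp only [Finset.sum_apply, Pi.smul_apply, Pi.sub_apply, realVec, smul_eq_mul] at this
  linarith

/-- The orientation sign turns the determinant of `(γ, ξ)` into its absolute value. -/
lemma orientationSign_mul_det {d : ℕ} (w γ : Fin (d + 1) → ℤ) (ξ : Fin d → Fin (d + 1) → ℤ)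
    (hγ : ∑ i, γ i * w i = 1) (e : Fin d → ℝ)
    (he : ∀ i, (w i : ℝ) = sqLength w * γ i + ∑ l, e l * ξ l i) :
    (orientationSign w ξ : ℝ) *
      ((Matrix.det (Matrix.of (Fin.cons γ ξ : Fin (d + 1) → Fin (d + 1) → ℤ)) : ℤ) : ℝ) =
      |((Matrix.det (Matrix.of (Fin.cons γ ξ : Fin (d + 1) → Fin (d + 1) → ℤ)) : ℤ) : ℝ)| := by
  have hS := sqLength_pos hγ
  have hcast : ∀ u : Fin (d + 1) → ℤ,
      ((Matrix.det (Matrix.of (Fin.cons u ξ : Fin (d + 1) → Fin (d + 1) → ℤ)) : ℤ) : ℝ) =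
      Matrix.det (Matrix.of (Fin.cons (realVec u) (fun k => realVec (ξ k)) :
        Fin (d + 1) → Fin (d + 1) → ℝ)) := fun u => by
    rw [← det_realVec]
    congr 1
    ext r i
    refine Fin.cases ?_ (fun k => ?_) r <;> simp
  -- Modulo the `ξ_l`, `w` equals `|w|²γ`. The two determinants therefore differ by a positive
  -- factor and have the same sign.
  have hdet : ((Matrix.det (Matrix.of (Fin.cons w ξ : Fin (d + 1) → Fin (d + 1) → ℤ)) : ℤ) : ℝ) =
      sqLength w *
        ((Matrix.det (Matrix.of (Fin.cons γ ξ : Fin (d + 1) → Fin (d + 1) → ℤ)) : ℤ) : ℝ) := by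
    have hw : realVec w = sqLength w • realVec γ + ∑ l, e l • realVec (ξ l) := by
      funext i
      simpa [realVec, Finset.sum_apply] using he i
    rw [hcast, hcast, hw, det_cons_smul_add]
  unfold orientationSign
  generalize Matrix.det (Matrix.of (Fin.cons w ξ : Fin (d + 1) → Fin (d + 1) → ℤ)) = D' at hdet ⊢
  generalize Matrix.det (Matrix.of (Fin.cons γ ξ : Fin (d + 1) → Fin (d + 1) → ℤ)) = D at hdet ⊢
  rcases lt_trichotomy D 0 with h | h | h
  · have hD : (D : ℝ) < 0 := by exact_mod_cast h
    have hD' : D' < 0 := by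
      have : (D' : ℝ) < 0 := by rw [hdet]; exact mul_neg_of_pos_of_neg hS hD
      exact_mod_cast this
    rw [Int.sign_eq_neg_one_of_neg hD', abs_of_neg hD]
    simp
  · simp [h]
  · have hD : (0 : ℝ) < D := by exact_mod_cast h
    have hD' : 0 < D' := by
      have : (0 : ℝ) < D' := by rw [hdet]; exact mul_pos hS hD
      exact_mod_cast this
    rw [Int.sign_eq_one_of_pos hD', abs_of_pos hD]
    simp

section solutionMap

variable {d p : ℕ} {v : Fin p → Fin (d + 1) → ℤ} {lam : Fin p → ℝ} {j : Fin p}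
  {U : Set (Fin (d + 1) → ℝ)} {t : ℝ} {ρ : (Fin (d + 1) → ℝ) → ℝ} {γ : Fin (d + 1) → ℤ}
  {ξ : Fin d → Fin (d + 1) → ℤ} {x : Fin (d + 1) → ℝ} {T : (Fin d → ℝ) → ℝ × ℝ} {r : ℝ}

/-- A shift of `η_k` by `2π` does not move the point, so both values of `T` solve the same equation;
uniqueness identifies them. -/
lemma solution_map_periodic (hT : ∀ η s, IsSolution v lam j U t ρ γ ξ x η s ↔ s = T η)
    (η : Fin d → ℝ) (k : Fin d) :
    T (Function.update η k 0) = T (Function.update η k (2 * Real.pi)) := by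
  rw [← hT]
  have h := (hT (Function.update η k 0) _).2 rfl
  unfold IsSolution at h ⊢
  rwa [zPoint_update_two_pi]

lemma Wj_zPoint_eq_WjConst (ht : Real.log t ≠ 0) (w : Fin (d + 1) → ℤ) {τ : ℝ}
    (hr : ρ (x + τ • realVec w) = r) (α : ℝ) (η : Fin d → ℝ) :
    Wj v lam j t ρ (zPoint w γ ξ t x τ α η) =
      WjConst v lam j t r (zPoint w γ ξ t x τ α η) := by
  unfold WjConst Wj
  rw [LogT_zPoint γ ξ w ht, hr]

/-- A zero would make `α + η_a`, reduced modulo `2π`, a second solution over the same point of the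
amoeba. Uniqueness then makes `η_a` an integral multiple of `2π`, impossible strictly between `0`
and `2π`. -/
lemma WjConst_fiberZ_ne_zero (ht : Real.log t ≠ 0)
    (hT : ∀ η s, IsSolution v lam j U t ρ γ ξ x η s ↔ s = T η)
    (hr : ∀ η, ρ (x + (T η).1 • realVec (v j)) = r) (s : Fin (d + 2) → ℝ)
    (h0 : 0 < s 1) (h1 : s 1 < 2 * Real.pi) :
    WjConst v lam j t r (fiberZ (v j) γ ξ t x T s) ≠ 0 := by
  intro hW
  rw [fiberZ, ← Wj_zPoint_eq_WjConst ht (v j) (hr _)] at hW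
  set η := etaProj d s
  obtain ⟨hα, hβ, -⟩ := (hT η (T η)).2 rfl
  set α' := toIcoMod Real.two_pi_pos 0 ((T η).2 + s 1) with hα'
  have hmod := self_sub_toIcoMod Real.two_pi_pos 0 ((T η).2 + s 1)
  set m := toIcoDiv Real.two_pi_pos 0 ((T η).2 + s 1)
  rw [zsmul_eq_mul] at hmod
  have heq : (T η).2 + s 1 = α' + m * (2 * Real.pi) := by rw [← hmod]; ring
  rw [heq, zPoint_add_int_mul_two_pi] at hW
  have hmem := toIcoMod_mem_Ico Real.two_pi_pos 0 ((T η).2 + s 1)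
  rw [zero_add] at hmem
  have hsol := congrArg Prod.snd ((hT η ((T η).1, α')).1 ⟨hmem, hβ, hW⟩)
  simp only at hsol
  rw [hsol] at heq
  have h2 : s 1 = m * (2 * Real.pi) := by linarith
  have hpi := Real.two_pi_pos
  have h3 : (0 : ℝ) < m := by
    by_contra hm
    nlinarith
  have h4 : (m : ℝ) < 1 := by
    by_contra hm
    nlinarith
  have h5 : 0 < m := by exact_mod_cast h3
  have h6 : m < 1 := by exact_mod_cast h4
  omega

/-- The value of `ρ ∘ Log_t` is `r` at every point of the fiber, since `η_a` changes only phases.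
This is an equality of functions of the parameters, so derivatives and pullbacks may be computed
with the constant `r`. -/
lemma singularFiber_eq_fiberMap (ht : Real.log t ≠ 0)
    (hT : ∀ η s, IsSolution v lam j U t ρ γ ξ x η s ↔ s = T η)
    (hr : ∀ η, ρ (x + (T η).1 • realVec (v j)) = r) :
    singularFiber v lam j U t ρ γ ξ x = fiberMap (v j) γ ξ t x T (WjConst v lam j t r) := by
  funext s
  have hsol : solution v lam j U t ρ γ ξ x (etaProj d s) = T (etaProj d s) :=
    (hT _ _).1 (Classical.epsilon_spec (p := IsSolution v lam j U t ρ γ ξ x (etaProj d s))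
      ⟨T (etaProj d s), (hT _ _).2 rfl⟩)
  change (let τα : ℝ × ℝ := solution v lam j U t ρ γ ξ x (etaProj d s)
    let z := zPoint (v j) γ ξ t x τα.1 (τα.2 + s 1) (etaProj d s)
    let w : ℂ := Wj v lam j t ρ z
    ((z, ((Real.sqrt ‖w‖ : ℝ) : ℂ) * Complex.exp (Complex.I * (s 0 : ℂ)),
      w / ((Real.sqrt ‖w‖ : ℝ) : ℂ) * Complex.exp (-(Complex.I * (s 0 : ℂ)))) :
        Ambient (d + 1))) = _
  simp only [hsol, Wj_zPoint_eq_WjConst ht (v j) (hr (etaProj d s))]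
  rfl

end solutionMap

end TropicalPeriod

end

/-! ### The theorem. -/

open TropicalPeriod in
theorem mainTheorem3 {d p : ℕ} (v : Fin p → Fin (d + 1) → ℤ) (lam : Fin p → ℝ) (j : Fin p)
    (N : FacetNeighborhoods v lam j)
    (f : Fin d → TropPoly (d + 1)) (a : Fin (d + 1) → ℝ) (ξ : Fin d → Fin (d + 1) → ℤ)
    (haU : a ∈ N.U) (he : IsEdgeEnd v lam j f a ξ)
    (γ : Fin (d + 1) → ℤ) (hγ : ∑ i, γ i * v j i = 1)
    (K : Set (Fin (d + 1) → ℝ)) (hK : K ⊆ N.U ∩ facet v lam j)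
    (hKU : ∃ δ : ℝ, 0 < δ ∧ ∀ x ∈ K, ∀ r : ℝ, |r| < δ → x + r • realVec (v j) ∈ N.U) :
    ∃ t₀ : ℝ, 0 < t₀ ∧ ∀ t : ℝ, 0 < t → t < t₀ →
      ∀ ρ : (Fin (d + 1) → ℝ) → ℝ, IsCutoff N t ρ → ∀ x ∈ K,
        (∀ η : Fin d → ℝ, ∃! s : ℝ × ℝ, IsSolution v lam j N.U t ρ γ ξ x η s) ∧
        Set.MapsTo (singularFiber v lam j N.U t ρ γ ξ x) (cube (d + 2))
          (simpleModel v lam j t ρ) ∧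
        ContinuousOn (singularFiber v lam j N.U t ρ γ ξ x) (cube (d + 2)) ∧
        (∀ s ∈ cube (d + 2), ∀ b : Fin (d + 2),
          singularFiber v lam j N.U t ρ γ ξ x (Function.update s b 0) =
            singularFiber v lam j N.U t ρ γ ξ x (Function.update s b (2 * Real.pi))) ∧
        (∀ᵐ s ∂(MeasureTheory.volume.restrict (cube (d + 2))),
          (singularFiber v lam j N.U t ρ γ ξ x s).2.1 ≠ 0 ∧
            DifferentiableAt ℝ (singularFiber v lam j N.U t ρ γ ξ x) s) ∧
        MeasureTheory.IntegrableOn (pullbackOmega (singularFiber v lam j N.U t ρ γ ξ x))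
          (cube (d + 2)) ∧
        integralOnSingularFiber v lam j N.U t ρ γ ξ x =
          (2 * (Real.pi : ℂ) * Complex.I) ^ (d + 2) * (edgeWeight f a : ℂ) := by
  obtain ⟨δ, hδ, hKδ⟩ := hKU
  obtain ⟨c, hc, hcU⟩ := exists_uniform_gap N ⟨haU, he.mem_facet⟩
  obtain ⟨ε, hε, φ, hφ⟩ := exists_perturbed_root (perturbRe v j) (perturbIm v γ)
  obtain ⟨t₀, ht₀, hsmall⟩ := exists_small_parameter p hc hε hδ (sqLength_pos hγ)
  obtain ⟨e, hcoord⟩ := exists_coordinates (v j) γ ξ hγ he.indep he.perp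
  refine ⟨t₀, ht₀, fun t ht htt₀ ρ hρ x hx => ?_⟩
  obtain ⟨ht1, htp, htε, htδ⟩ := hsmall t ht htt₀
  have hlog : Real.log t ≠ 0 := (Real.log_neg ht ht1).ne
  obtain ⟨T, r, hTc, hT, hr⟩ := exists_solution_map γ ξ N hγ he.perp hφ hcU ht ht1 htp htε htδ hρ
    (hK hx) (hKδ x hx)
  have hper := solution_map_periodic hT
  have hne := WjConst_fiberZ_ne_zero hlog hT hr
  have hg := differentiableAt_WjConst v lam j t r
  obtain ⟨hint, hval⟩ := integral_pullbackOmega_fiberMap (v j) γ ξ t x hTc hg hper hne _ e hcoord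
  unfold integralOnSingularFiber
  rw [singularFiber_eq_fiberMap hlog hT hr]
  refine ⟨fun η => ⟨T η, (hT η _).2 rfl, fun s hs => (hT η s).1 hs⟩, fun s _ => ⟨fun i => ?_, ?_⟩,
    (continuous_fiberMap (v j) γ ξ t x hTc hg).continuousOn,
    fun s _ b => fiberMap_update_two_pi (v j) γ ξ t x hper s b,
    ae_cube_of_forall fun s h0 h1 => ⟨fiberMap_u_ne_zero (v j) γ ξ t x (hne s h0 h1),
      differentiableAt_fiberMap (v j) γ ξ t x hTc hg (hne s h0 h1)⟩, hint, ?_⟩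
  · exact zPoint_ne_zero (v j) γ ξ t x _ _ _ i
  · rw [fiberMap_u_mul_v]
    exact (Wj_zPoint_eq_WjConst hlog (v j) (hr _) _ _).symm
  · rw [hval, edgeWeight_eq_abs_det he γ hγ, ← orientationSign_mul_det (v j) γ ξ hγ e hcoord]
    rw [Complex.ofReal_mul, Complex.ofReal_intCast, Complex.ofReal_intCast]
    ring
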